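/- Conventions. A high-level net has colours $Col\neq\emptyset$, variables, places $P$, transitions $T$, a flow function $F(p,x,t),F(t,x,p)\in\mathbb N$, and for every $t\in T$ a guard, a predicate on the variables $V(t)$ occurring on arcs at $t$; a high-level Petri net $N$ also has a nonempty set of initial markings (multisets over $P\times Col$), all putting equally many colours on each place. A transition $t$ fires in a mode $\sigma:V(t)\to Col$ satisfying its guard by removing $(p,\sigma(x))$ for the arcs $(p,x,t)$ and adding $(p,\sigma(x))$ for the arcs $(t,x,p)$. $N$ is finite if $P,T,F$ are finite, and safe if every reachable marking has at most one colour on every place. Let $N$ be a finite safe high-level Petri net, let $\ll$ be an arbitrary total order on $T$, and let $(O,h)$ be the symbolic unfolding of $N$ (in the sense of Chatain and Jard), i.e. its symbolic branching process that is maximal with respect to the prefix relation, with events $E$ and labelling $h$. A configuration is a causally closed set of events without structural conflict and without colour conflict; an instantiation $\theta$ of a configuration $C$ assigns colours to the variables of the events in $C$ and of the initial event $\bot$ such that the predicates of these events hold; $\mathrm{Cut}(C)$ is the set of conditions that hold after $C$, $M(C,\theta)$ the marking of $N$ that it represents under $\theta$, and $\mathcal M(C)$ the set of all $M(C,\theta)$.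 $C\oplus D$ denotes $C\cup D$ if $C\cap D=\emptyset$ and $C\cup D$ is a configuration, and $C[\![M]\!]D$ means that some instantiation $\theta$ of $C\oplus D$ restricts to an instantiation of $C$ with marking $M$. $O(C|D)$ is the subnet of $O$ with conditions $\mathrm{Cut}(C)$ and all conditions adjacent to $D$, and with events $D$; ${\Uparrow}C$ is the subnet of all nodes that are neither in $C$ nor consumed by $C$, in structural conflict with no event of $C$, and not in colour conflict together with $C$. A strict partial order $\prec$ on the finite configurations is adequate if (i) it is well-founded, (ii) $C_1\subsetneq C_2$ implies $C_1\prec C_2$, and (iii) whenever $C_1,C_2$ are finite configurations, $C_1\oplus D$ is a finite extension of $C_1$, and there is $M\in\mathcal M(C_1)\cap\mathcal M(C_2)$ with $C_1[\![M]\!]D$, then for the label-preserving net monomorphism $\varphi:O(C_1|D)\to{\Uparrow}C_2$ with $\varphi(\mathrm{Cut}(C_1))=\mathrm{Cut}(C_2)$ the set $C_2\oplus\varphi(D)$ is a finite configuration and $C_1\prec C_2$ implies $C_1\oplus D\prec C_2\oplus\varphi(D)$. For a finite set $X$ of events let $\mathfrak p(X)$ be the $\ll$-sorted sequence of the labels of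 the events in $X$, with multiplicities. The Foata normal form of a finite configuration $C$ is the sequence $C^1C^2\dots C^n$ of nonempty sets obtained by repeatedly removing from $C$ the set of its causally minimal events. Define on finite configurations: - $C_1\prec_M C_2$ iff $|C_1|<|C_2|$; - $C_1\prec_E C_2$ iff $|C_1|<|C_2|$, or $|C_1|=|C_2|$ and $\mathfrak p(C_1)$ is lexicographically smaller than $\mathfrak p(C_2)$; - $C_1\prec_F C_2$ iff $C_1\prec_E C_2$, or $\mathfrak p(C_1)=\mathfrak p(C_2)$ and there is an $i$ such that both Foata normal forms have an $i$-th set, $\mathfrak p(C_1^j)=\mathfrak p(C_2^j)$ for all $j<i$, and $\mathfrak p(C_1^i)$ is smaller than $\mathfrak p(C_2^i)$ in the length-lexicographic order (shorter sequences first, sequences of the same length lexicographically). Then $\prec_M$, $\prec_E$ and $\prec_F$ are adequate orders, and $\prec_F$ is total: for all finite configurations $C_1\neq C_2$, $C_1\prec_F C_2$ or $C_2\prec_F C_1$. -/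

import Mathlib

/-!
High-level Petri nets, their symbolic branching processes and unfoldings, configurations and
adequate orders.  Multisets are Mathlib's (finite) multisets.
-/

namespace HLPetri

universe u v

/-- A high-level net structure with colours `Col`, variables `Var`, places `P`, transitions `T`.
`pre t` is the multiset of pairs `(p, x)` with multiplicity `F(p, x, t)`, and `post t` the multiset
of pairs `(p, x)` with multiplicity `F(t, x, p)`.  A guard is a predicate on assignments that only
looks at the variables on the arcs at `t`. -/
structure NetStructure (Col Var P T : Type*) where
  pre : T → Multiset (P × Var)
  post : T → Multiset (P × Var)
  guard : T → (Var → Col) → Prop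
  guard_local : ∀ (t : T) (σ τ : Var → Col),
    (∀ x : Var, (∃ p : P, (p, x) ∈ pre t ∨ (p, x) ∈ post t) → σ x = τ x) →
      (guard t σ ↔ guard t τ)

/-- A high-level Petri net: a net structure with a nonempty set of initial markings, all of which
put the same number of colours on each place. -/
structure HLNet (Col Var P T : Type*) extends NetStructure Col Var P T where
  init : Set (Multiset (P × Col))
  init_nonempty : init.Nonempty
  init_places : ∀ M ∈ init, ∀ M' ∈ init, M.map Prod.fst = M'.map Prod.fst

namespace NetStructure

variable {Col Var P T : Type*} (N : NetStructure Col Var P T)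

/-- The tokens consumed by `t` in mode `σ`. -/
def preMode (t : T) (σ : Var → Col) : Multiset (P × Col) :=
  (N.pre t).map fun a => (a.1, σ a.2)

/-- The tokens produced by `t` in mode `σ`. -/
def postMode (t : T) (σ : Var → Col) : Multiset (P × Col) :=
  (N.post t).map fun a => (a.1, σ a.2)

open Classical in
/-- `t` fires in mode `σ` from `M` and leads to `M'`. -/
def Fires (M : Multiset (P × Col)) (t : T) (σ : Var → Col) (M' : Multiset (P × Col)) : Prop :=
  N.guard t σ ∧ N.preMode t σ ≤ M ∧ M' = M - N.preMode t σ + N.postMode t σ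

/-- `p → t` for a place `p` and a transition `t`. -/
def Consumes (t : T) (p : P) : Prop := ∃ x : Var, (p, x) ∈ N.pre t

/-- `t → p` for a transition `t` and a place `p`. -/
def Produces (t : T) (p : P) : Prop := ∃ x : Var, (p, x) ∈ N.post t

/-- The arrow relation on nodes; `Sum.inl` marks places and `Sum.inr` marks transitions. -/
inductive Arrow : P ⊕ T → P ⊕ T → Prop
  | consume (p : P) (t : T) (h : N.Consumes t p) : Arrow (Sum.inl p) (Sum.inr t)
  | produce (t : T) (p : P) (h : N.Produces t p) : Arrow (Sum.inr t) (Sum.inl p)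

/-- `x ≤ y`. -/
def NodeLE : P ⊕ T → P ⊕ T → Prop := Relation.ReflTransGen N.Arrow

/-- `x < y`. -/
def NodeLT : P ⊕ T → P ⊕ T → Prop := Relation.TransGen N.Arrow

/-- At most one arc from any node to any other node. -/
def Ordinary : Prop :=
  ∀ t : T, ((N.pre t).map Prod.fst).Nodup ∧ ((N.post t).map Prod.fst).Nodup

/-- Structural conflict `x ♯ y`. -/
def Conflict (x y : P ⊕ T) : Prop :=
  ∃ (p : P) (t t' : T), t ≠ t' ∧ N.Consumes t p ∧ N.Consumes t' p ∧
    N.NodeLE (Sum.inr t) x ∧ N.NodeLE (Sum.inr t') y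

/-- `→ C`: the places consumed from by some transition in `C`. -/
def preSet (C : Set T) : Set P := {p | ∃ t ∈ C, N.Consumes t p}

/-- `C →`: the places produced on by some transition in `C`. -/
def postSet (C : Set T) : Set P := {p | ∃ t ∈ C, N.Produces t p}

end NetStructure

namespace HLNet

variable {Col Var P T : Type*} (N : HLNet Col Var P T)

/-- The markings reachable from an initial marking. -/
inductive Reachable : Multiset (P × Col) → Prop
  | init (M : Multiset (P × Col)) (h : M ∈ N.init) : Reachable M
  | step (M M' : Multiset (P × Col)) (t : T) (σ : Var → Col)
      (h : Reachable M) (hf : N.Fires M t σ M') : Reachable M'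

open Classical in
/-- In every reachable marking there is at most one colour on every place. -/
def Safe : Prop :=
  ∀ M : Multiset (P × Col), N.Reachable M → ∀ p : P, M.countP (fun a => a.1 = p) ≤ 1

open Classical in
/-- High-level occurrence nets. -/
structure IsOccurrenceNet : Prop where
  ordinary : N.Ordinary
  no_self_conflict : ∀ e : T, ¬ N.Conflict (Sum.inr e) (Sum.inr e)
  acyclic : ∀ x : P ⊕ T, ¬ N.NodeLT x x
  wellFounded : WellFounded N.NodeLT
  cond : ∀ b : P, Xor
    ((∀ K ∈ N.init, K.countP (fun a => a.1 = b) = 1) ∧ ¬ ∃ e : T, N.Produces e b)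
    ((∀ K ∈ N.init, K.countP (fun a => a.1 = b) = 0) ∧
      ∃! ex : T × Var, (b, ex.2) ∈ N.post ex.1)

end HLNet

/-- Homomorphisms of net structures, given by their parts on places and on transitions. -/
structure IsHom {Col Var P T P' T' : Type*} (N : NetStructure Col Var P T)
    (N' : NetStructure Col Var P' T') (fP : P → P') (fT : T → T') : Prop where
  guard : ∀ t : T, N.guard t = N'.guard (fT t)
  pre : ∀ t : T, N'.pre (fT t) = (N.pre t).map fun a => (fP a.1, a.2)
  post : ∀ t : T, N'.post (fT t) = (N.post t).map fun a => (fP a.1, a.2)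

/-- Initial homomorphisms: the initial markings are mapped onto the initial markings. -/
structure IsInitialHom {Col Var P T P' T' : Type*} (N : HLNet Col Var P T)
    (N' : HLNet Col Var P' T') (fP : P → P') (fT : T → T') : Prop
    extends IsHom N.toNetStructure N'.toNetStructure fP fT where
  init : (fun M : Multiset (P × Col) => M.map fun a => (fP a.1, a.2)) '' N.init = N'.init

/-- The indexed variables: `x_e` for a variable `x` and an event `e`, and the variable of the
special initial event that determines the initial colour of the condition `b`. -/
inductive IVar (Var B E : Type*)
  | ofEvent (e : E) (x : Var)
  | ofBot (b : B)

/-! Notions for an occurrence net `O` with conditions `B` and events `E`. -/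
namespace HLNet

variable {Col Var B E : Type*} (O : HLNet Col Var B E)

open Classical in
/-- The indexed variable whose value is the colour put on `b`.  In an occurrence net the event and
the variable chosen here are the only ones with an arc to `b`. -/
noncomputable def source (b : B) : IVar Var B E :=
  if h : ∃ ex : E × Var, (b, ex.2) ∈ O.post ex.1 then IVar.ofEvent h.choose.1 h.choose.2
  else IVar.ofBot b

/-- The predicate of the special initial event, evaluated under `θ`. -/
def PredBot (θ : IVar Var B E → Col) : Prop :=
  ∃ K ∈ O.init, ∀ a ∈ K, θ (IVar.ofBot a.1) = a.2

/-- The local predicate of an event, evaluated under `θ`. -/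
def LocPred (e : E) (θ : IVar Var B E → Col) : Prop :=
  O.guard e (fun x => θ (IVar.ofEvent e x)) ∧
    ∀ a ∈ O.pre e, θ (IVar.ofEvent e a.2) = θ (O.source a.1)

/-- The predicate of an event, evaluated under `θ`. -/
def Pred (e : E) (θ : IVar Var B E → Col) : Prop :=
  O.PredBot θ ∧ ∀ e' : E, O.NodeLE (Sum.inr e') (Sum.inr e) → O.LocPred e' θ

/-- The predicate of the event (possibly the initial one) that produces the condition `b`. -/
def PredCond (b : B) (θ : IVar Var B E → Col) : Prop :=
  match O.source b with
  | IVar.ofEvent e _ => O.Pred e θ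
  | IVar.ofBot _ => O.PredBot θ

/-- A set of nodes is in colour conflict. -/
def ColorConflict (X : Set (B ⊕ E)) : Prop :=
  ¬ ∃ θ : IVar Var B E → Col,
    (∀ e : E, Sum.inr e ∈ X → O.Pred e θ) ∧ (∀ b : B, Sum.inl b ∈ X → O.PredCond b θ)

/-- (Symbolic) configurations. -/
structure IsConfiguration (C : Set E) : Prop where
  conflict_free : ∀ e ∈ C, ∀ e' ∈ C, ¬ O.Conflict (Sum.inr e) (Sum.inr e')
  color_free : ¬ O.ColorConflict (Sum.inr '' C)
  causally_closed : ∀ e ∈ C, ∀ e' : E, O.NodeLE (Sum.inr e') (Sum.inr e) → e' ∈ C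

/-- The finite configurations. -/
def FinConfig : Type _ := {C : Set E // O.IsConfiguration C ∧ C.Finite}

/-- The conditions occupied in the initial cuts. -/
def initConds : Set B := {b | ∃ K ∈ O.init, ∃ c : Col, (b, c) ∈ K}

/-- The cut of a set of events. -/
def cut (C : Set E) : Set B := (O.initConds ∪ O.postSet C) \ O.preSet C

/-- `θ` is an instantiation of `C`.  Only the values of `θ` at the indexed variables of `C` and of
the initial event matter. -/
def IsInstantiation (C : Set E) (θ : IVar Var B E → Col) : Prop :=
  O.PredBot θ ∧ ∀ e ∈ C, O.Pred e θ

/-- The marking of the finite configuration `C` instantiated by `θ`, with labels given by `hB`;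
the sum of one singleton for each condition in the (finite) cut of `C`. -/
noncomputable def mark {P : Type*} (hB : B → P) (C : Set E) (θ : IVar Var B E → Col) :
    Multiset (P × Col) :=
  ∑ᶠ b ∈ O.cut C, {(hB b, θ (O.source b))}

/-- All markings represented by the configuration `C`. -/
def marks {P : Type*} (hB : B → P) (C : Set E) : Set (Multiset (P × Col)) :=
  {M | ∃ θ : IVar Var B E → Col, O.IsInstantiation C θ ∧ O.mark hB C θ = M}

/-- `C ⟦M⟧ D`: the events of `D` can fire from the marking `M` of `C`. -/
def CanExtend {P : Type*} (hB : B → P) (C : Set E) (M : Multiset (P × Col)) (D : Set E) : Prop :=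
  ∃ θ : IVar Var B E → Col, O.IsInstantiation (C ∪ D) θ ∧ O.mark hB C θ = M

/-- The conditions of the occurrence net around the suffix `D` of `C` (its events are `D`). -/
def aroundConds (C D : Set E) : Set B := O.cut C ∪ O.preSet D ∪ O.postSet D

/-- The nodes of the future of `C`. -/
def futureNodes (C : Set E) : Set (B ⊕ E) :=
  {x | x ∉ Sum.inl '' O.preSet C ∪ Sum.inr '' C ∧
    (∀ y ∈ C, ¬ O.Conflict (Sum.inr y) x) ∧
    ¬ O.ColorConflict (Sum.inr '' C ∪ {x})}

/-- The conditions of the future of `C`. -/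
def futureConds (C : Set E) : Set B := {b | Sum.inl b ∈ O.futureNodes C}

/-- The events of the future of `C`. -/
def futureEvents (C : Set E) : Set E := {e | Sum.inr e ∈ O.futureNodes C}

open Classical in
/-- `(fB, fE)` is an injective homomorphism from the subnet of `O` with conditions `B₁` and events
`E₁` to the subnet with conditions `B₂` and events `E₂`, the arcs of each subnet being those of `O`
between its nodes.  Values of `fB` and `fE` outside `B₁` and `E₁` are irrelevant. -/
structure IsSubnetMono (B₁ : Set B) (E₁ : Set E) (B₂ : Set B) (E₂ : Set E)
    (fB : B → B) (fE : E → E) : Prop where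
  mapsTo_conds : Set.MapsTo fB B₁ B₂
  mapsTo_events : Set.MapsTo fE E₁ E₂
  injOn_conds : Set.InjOn fB B₁
  injOn_events : Set.InjOn fE E₁
  guard : ∀ e ∈ E₁, O.guard e = O.guard (fE e)
  pre : ∀ e ∈ E₁, (O.pre (fE e)).filter (fun a => a.1 ∈ B₂) =
    ((O.pre e).filter (fun a => a.1 ∈ B₁)).map fun a => (fB a.1, a.2)
  post : ∀ e ∈ E₁, (O.post (fE e)).filter (fun a => a.1 ∈ B₂) =
    ((O.post e).filter (fun a => a.1 ∈ B₁)).map fun a => (fB a.1, a.2)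

/-- `(fB, fE)` is the monomorphism from the net around the suffix `D` of `C₁` to the future of `C₂`
that maps the cut of `C₁` onto the cut of `C₂` and preserves labels. -/
structure IsExtMono {P T : Type*} (hB : B → P) (hE : E → T) (C₁ D C₂ : Set E)
    (fB : B → B) (fE : E → E) : Prop
    extends O.IsSubnetMono (O.aroundConds C₁ D) D (O.futureConds C₂) (O.futureEvents C₂) fB fE where
  image_cut : fB '' O.cut C₁ = O.cut C₂
  label_conds : ∀ b ∈ O.aroundConds C₁ D, hB (fB b) = hB b
  label_events : ∀ e ∈ D, hE (fE e) = hE e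

/-- Adequate orders on the finite configurations of `O`, whose nodes are labelled by `hB`, `hE`.
In the last clause `C₁'` is the extension of `C₁` by `D`, and `C₂'` the extension of `C₂` by the
image of `D`. -/
structure IsAdequateOrder {P T : Type*} (hB : B → P) (hE : E → T)
    (r : O.FinConfig → O.FinConfig → Prop) : Prop where
  irrefl : ∀ C, ¬ r C C
  trans : ∀ C₁ C₂ C₃, r C₁ C₂ → r C₂ C₃ → r C₁ C₃
  wellFounded : WellFounded r
  of_ssubset : ∀ C₁ C₂ : O.FinConfig, C₁.1 ⊂ C₂.1 → r C₁ C₂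
  extension : ∀ (C₁ C₂ C₁' : O.FinConfig) (D : Set E),
    Disjoint C₁.1 D → C₁'.1 = C₁.1 ∪ D →
    (∃ M ∈ O.marks hB C₁.1 ∩ O.marks hB C₂.1, O.CanExtend hB C₁.1 M D) →
    ∀ (fB : B → B) (fE : E → E), O.IsExtMono hB hE C₁.1 D C₂.1 fB fE →
      ∃ C₂' : O.FinConfig, Disjoint C₂.1 (fE '' D) ∧ C₂'.1 = C₂.1 ∪ fE '' D ∧
        (r C₁ C₂ → r C₁' C₂')

/-- The size order. -/
def sizeOrder (C₁ C₂ : O.FinConfig) : Prop := C₁.1.ncard < C₂.1.ncard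

/-- The causally minimal events of `X`. -/
def minEvents (X : Set E) : Set E :=
  {e ∈ X | ∀ e' ∈ X, ¬ O.NodeLT (Sum.inr e') (Sum.inr e)}

/-- What is left of `C` after removing the minimal events `i` times. -/
def foataRest (C : Set E) : ℕ → Set E
  | 0 => C
  | i + 1 => foataRest C i \ O.minEvents (foataRest C i)

/-- The slice with index `i` (counted from `0`) of the Foata normal form of `C`.  The normal form
of a finite set consists of the slices before the first empty one. -/
def foataSlice (C : Set E) (i : ℕ) : Set E := O.minEvents (O.foataRest C i)

end HLNet

/-- For a finite set `X` of events, the sequence of the labels of the events in `X` (with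
multiplicities), in the given order of the transitions. -/
noncomputable def parikh {E T : Type*} [LinearOrder T] (hE : E → T) (X : Set E) : List T :=
  (∑ᶠ e ∈ X, ({hE e} : Multiset T)).sort (· ≤ ·)

namespace HLNet

variable {Col Var B E T : Type*} [LinearOrder T] (O : HLNet Col Var B E) (hE : E → T)

/-- The order that compares sizes first and then, lexicographically, the ordered sequences of
labels. -/
def parikhOrder (C₁ C₂ : O.FinConfig) : Prop :=
  C₁.1.ncard < C₂.1.ncard ∨
    (C₁.1.ncard = C₂.1.ncard ∧ List.Lex (· < ·) (parikh hE C₁.1) (parikh hE C₂.1))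

/-- Comparison of the Foata normal forms of `C₁` and `C₂`: at the first slice where the sequences
of labels differ, the one of `C₁` is shorter, or equally long and lexicographically smaller. -/
def FoataLT (C₁ C₂ : Set E) : Prop :=
  ∃ i : ℕ, (O.foataSlice C₁ i).Nonempty ∧ (O.foataSlice C₂ i).Nonempty ∧
    (∀ j < i, parikh hE (O.foataSlice C₁ j) = parikh hE (O.foataSlice C₂ j)) ∧
    List.Shortlex (· < ·) (parikh hE (O.foataSlice C₁ i)) (parikh hE (O.foataSlice C₂ i))

/-- The order that compares sizes, then the sequences of labels, then the Foata normal forms. -/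
def foataOrder (C₁ C₂ : O.FinConfig) : Prop :=
  C₁.1.ncard < C₂.1.ncard ∨
    (C₁.1.ncard = C₂.1.ncard ∧ List.Lex (· < ·) (parikh hE C₁.1) (parikh hE C₂.1)) ∨
    (parikh hE C₁.1 = parikh hE C₂.1 ∧ O.FoataLT hE C₁.1 C₂.1)

end HLNet

/-- `(O, hB, hE)` is a symbolic branching process of `N`. -/
structure IsBranchingProcess {Col Var P T B E : Type*} (N : HLNet Col Var P T)
    (O : HLNet Col Var B E) (hB : B → P) (hE : E → T) : Prop where
  occurrence : O.IsOccurrenceNet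
  satisfiable : ∀ e : E, ∃ θ : IVar Var B E → Col, O.Pred e θ
  hom : IsInitialHom O N hB hE
  inj : ∀ e e' : E, O.pre e = O.pre e' → hE e = hE e' → e = e'

/-- `(O, hB, hE)` is a prefix of `(O', hB', hE')`. -/
def IsPrefix {Col Var P T B E B' E' : Type*} (O : HLNet Col Var B E) (hB : B → P) (hE : E → T)
    (O' : HLNet Col Var B' E') (hB' : B' → P) (hE' : E' → T) : Prop :=
  ∃ (fB : B → B') (fE : E → E'), Function.Injective fB ∧ Function.Injective fE ∧
    IsInitialHom O O' fB fE ∧ hB' ∘ fB = hB ∧ hE' ∘ fE = hE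

/-- `(O, hB, hE)` is the symbolic unfolding of `N`: a symbolic branching process that is maximal
with respect to the prefix relation. -/
def IsSymbolicUnfolding {Col Var P T : Type*} {B : Type u} {E : Type v} (N : HLNet Col Var P T)
    (O : HLNet Col Var B E) (hB : B → P) (hE : E → T) : Prop :=
  IsBranchingProcess N O hB hE ∧
    ∀ (B' : Type u) (E' : Type v) (O' : HLNet Col Var B' E') (hB' : B' → P) (hE' : E' → T),
      IsBranchingProcess N O' hB' hE' → IsPrefix O hB hE O' hB' hE' → IsPrefix O' hB' hE' O hB hE

end HLPetri

/-! ### Causality, cuts and configurations in an occurrence net. -/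

namespace HLPetri

namespace NetStructure

variable {Col Var P T : Type*} {N : NetStructure Col Var P T}

/-! Everything rests on one consequence of safety. The marking represented by an instantiated finite
configuration is reachable in `N` (`reachable_mark`), so `hB` is injective on the cut of that
configuration (`injOn_cut`). A branching process has no two events with the same label and the same
incoming arcs; hence two equally labelled events that both consume only from one such cut coincide
(`eq_of_consumes_mem`).

Totality. The slice with index `n` consists of the events of causal height exactly `n`, and these
consume from the cut of the events of smaller height. So the label sequences of the slices determine
a configuration, slice by slice (`foataSlice_eq_of_parikh_eq`). Distinct configurations of equal
size with equal label sequences therefore have a first slice where the labels differ, and that slice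
decides. As `T` is finite, the same fact leaves only finitely many configurations of bounded size,
which makes `parikhOrder` and `foataOrder` well-founded.

Extensions. An instantiation of `C₁ ∪ D` and one of `C₂` are glued along the cuts, where they agree
because the markings are equal and labels identify conditions (`exists_isInstantiation_extension`).
Sizes and label multisets then grow by the same amount on both sides, which settles the first two
orders. For Foata normal forms the danger is that `D` sits at different heights above `C₁` and `C₂`.
By `suffixHom_eq_self` this cannot happen up to the deciding slice: events of `D` that low are fixed
by `fE`, so both normal forms receive the same events there. The heart of that lemma is
`mem_cut_of_parikh_eq`, which relies on the two configurations having equal label multisets;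
`foataOrder` looks at slices only in that case. -/

theorem consumes_iff {t : T} {p : P} : N.Consumes t p ↔ p ∈ (N.pre t).map Prod.fst := by
  simp [Consumes]

theorem produces_iff {t : T} {p : P} : N.Produces t p ↔ p ∈ (N.post t).map Prod.fst := by
  simp [Produces]

/-- A set of transitions that contains all causal predecessors of its elements. -/
def CausallyClosed (N : NetStructure Col Var P T) (C : Set T) : Prop :=
  ∀ e ∈ C, ∀ e' : T, N.NodeLE (Sum.inr e') (Sum.inr e) → e' ∈ C

theorem nodeLT_of_produces_of_consumes {e e' : T} {b : P} (h' : N.Produces e' b)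
    (h : N.Consumes e b) : N.NodeLT (Sum.inr e') (Sum.inr e) :=
  .tail (.single (.produce e' b h')) (.consume b e h)

/-- Induction backwards along a causal path. Paths alternate between places and transitions, so the
invariant at a place is that all its producers lie in `C`. -/
theorem causallyClosed_of_direct {C : Set T}
    (h : ∀ e ∈ C, ∀ e' b, N.Produces e' b → N.Consumes e b → e' ∈ C) : N.CausallyClosed C := by
  intro e he
  suffices H : ∀ x : P ⊕ T, N.NodeLE x (Sum.inr e) →
      Sum.rec (motive := fun _ => Prop) (fun b => ∀ e', N.Produces e' b → e' ∈ C)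
        (fun e' => e' ∈ C) x from fun e' h' => H _ h'
  intro x hx
  induction hx using Relation.ReflTransGen.head_induction_on with
  | refl => exact he
  | head hxy _ ih =>
    cases hxy with
    | consume b t hc => exact fun e' he' => h t ih e' b he' hc
    | produce t b hp => exact ih t hp

theorem CausallyClosed.mem_of_direct {C : Set T} (hC : N.CausallyClosed C) {e e' : T} {b : P}
    (he : e ∈ C) (h' : N.Produces e' b) (h : N.Consumes e b) : e' ∈ C :=
  hC e he e' (nodeLT_of_produces_of_consumes h' h).to_reflTransGen

theorem CausallyClosed.mem_of_lt {C : Set T} (hC : N.CausallyClosed C) {e e' : T}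
    (he : e ∈ C) (h : N.NodeLT (Sum.inr e') (Sum.inr e)) : e' ∈ C :=
  hC e he e' h.to_reflTransGen

theorem eq_or_nodeLT_of_nodeLE {x y : P ⊕ T} (h : N.NodeLE x y) : x = y ∨ N.NodeLT x y := by
  rcases Relation.reflTransGen_iff_eq_or_transGen.1 h with h | h
  · exact Or.inl h.symm
  · exact Or.inr h

end NetStructure

/-- Links the sums of singletons that define markings and label multisets to `Multiset.map`, the
form in which arcs are transported. -/
theorem finsum_mem_singleton_eq_map {α β : Type*} {m : Multiset α} (hm : m.Nodup) (f : α → β) :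
    ∑ᶠ b ∈ {b | b ∈ m}, ({f b} : Multiset β) = m.map f := by
  have h : {b | b ∈ m} = ((⟨m, hm⟩ : Finset α) : Set α) := by ext; simp
  rw [h, finsum_mem_coe_finset, Finset.sum, ← Multiset.sum_map_singleton (m.map f),
    Multiset.map_map]
  rfl

theorem mem_finsum_mem_singleton {α β : Type*} {s : Set α} (hs : s.Finite) (f : α → β) {c : β} :
    c ∈ ∑ᶠ b ∈ s, ({f b} : Multiset β) ↔ ∃ b ∈ s, f b = c := by
  have h := finsum_mem_singleton_eq_map hs.toFinset.nodup f
  have hs' : {b | b ∈ hs.toFinset.val} = s := by ext; simp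
  rw [hs'] at h
  simp [h]

theorem injOn_of_countP_finsum_le_one {α β γ : Type*} [DecidableEq γ] {s : Set α} (hs : s.Finite)
    {f : α → β} {g : β → γ}
    (h : ∀ c, (∑ᶠ b ∈ s, ({f b} : Multiset β)).countP (fun a => g a = c) ≤ 1) :
    Set.InjOn (g ∘ f) s := by
  intro a ha b hb hab
  by_contra hne
  have h' := finsum_mem_singleton_eq_map hs.toFinset.nodup f
  have hs' : {b | b ∈ hs.toFinset.val} = s := by ext; simp
  rw [hs'] at h'
  have h1 := h (g (f a))
  rw [h', Multiset.countP_map] at h1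
  have h2 : ({a, b} : Multiset α) ≤ hs.toFinset.val.filter fun x => g (f x) = g (f a) := by
    rw [Multiset.le_iff_subset (by simpa using hne)]
    intro x hx
    simp only [Multiset.insert_eq_cons, Multiset.mem_cons, Multiset.mem_singleton] at hx
    rcases hx with rfl | rfl <;> simp_all
  have := Multiset.card_le_card h2
  simp at this
  omega

namespace HLNet

open NetStructure

variable {Col Var B E : Type*} {O : HLNet Col Var B E}

theorem mem_initConds_iff {K : Multiset (B × Col)} (hK : K ∈ O.init)
    {b : B} : b ∈ O.initConds ↔ b ∈ K.map Prod.fst := by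
  constructor
  · rintro ⟨K', hK', c, hc⟩
    rw [O.init_places K hK K' hK']
    exact Multiset.mem_map_of_mem Prod.fst hc
  · intro h
    obtain ⟨a, ha, rfl⟩ := Multiset.mem_map.1 h
    exact ⟨K, hK, a.2, ha⟩

theorem finite_initConds : O.initConds.Finite := by
  classical
  obtain ⟨K, hK⟩ := O.init_nonempty
  refine (K.map Prod.fst).toFinset.finite_toSet.subset fun b hb => ?_
  simpa only [Finset.mem_coe, Multiset.mem_toFinset] using (mem_initConds_iff hK).1 hb

namespace IsOccurrenceNet

open Classical in
theorem not_produces_of_mem_initConds (hO : O.IsOccurrenceNet) {b : B} (hb : b ∈ O.initConds)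
    (e : E) : ¬ O.Produces e b := by
  obtain ⟨K, hK, c, hc⟩ := hb
  rcases hO.cond b with h | h
  · exact fun he => h.1.2 ⟨e, he⟩
  · have := h.1.1 K hK
    rw [Multiset.countP_eq_zero] at this
    exact absurd rfl (this _ hc)

open Classical in
theorem mem_initConds_or_produces (hO : O.IsOccurrenceNet) (b : B) :
    b ∈ O.initConds ∨ ∃ e, O.Produces e b := by
  rcases hO.cond b with h | h
  · obtain ⟨K, hK⟩ := O.init_nonempty
    have := h.1.1 K hK
    have h0 : 0 < K.countP (fun a => a.1 = b) := by omega
    obtain ⟨a, ha, rfl⟩ := Multiset.countP_pos.1 h0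
    exact Or.inl ⟨K, hK, a.2, ha⟩
  · obtain ⟨⟨e, x⟩, hx, -⟩ := h.1.2
    exact Or.inr ⟨e, x, hx⟩

theorem unique_post (hO : O.IsOccurrenceNet) {b : B} {e e' : E} {x x' : Var}
    (h : (b, x) ∈ O.post e) (h' : (b, x') ∈ O.post e') : e = e' ∧ x = x' := by
  rcases hO.cond b with H | H
  · exact absurd ⟨e, x, h⟩ H.1.2
  · obtain ⟨y, -, hy⟩ := H.1.2
    have h1 := hy (e, x) h
    have h2 := hy (e', x') h'
    simpa using h1.trans h2.symm

theorem produces_unique (hO : O.IsOccurrenceNet) {b : B} {e e' : E}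
    (h : O.Produces e b) (h' : O.Produces e' b) : e = e' := by
  obtain ⟨x, hx⟩ := h
  obtain ⟨x', hx'⟩ := h'
  exact (hO.unique_post hx hx').1

theorem source_of_mem_post (hO : O.IsOccurrenceNet) {b : B} {e : E} {x : Var}
    (h : (b, x) ∈ O.post e) : O.source b = IVar.ofEvent e x := by
  have h' : ∃ ex : E × Var, (b, ex.2) ∈ O.post ex.1 := ⟨(e, x), h⟩
  obtain ⟨h1, h2⟩ := hO.unique_post h'.choose_spec h
  rw [source, dif_pos h', h1, h2]

theorem source_of_mem_initConds (hO : O.IsOccurrenceNet) {b : B} (h : b ∈ O.initConds) :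
    O.source b = IVar.ofBot b := by
  rw [source, dif_neg]
  rintro ⟨⟨e, x⟩, hx⟩
  exact hO.not_produces_of_mem_initConds h e ⟨x, hx⟩

theorem nodup_init (hO : O.IsOccurrenceNet) {K : Multiset (B × Col)} (hK : K ∈ O.init) :
    (K.map Prod.fst).Nodup := by
  classical
  rw [Multiset.nodup_iff_count_le_one]
  intro b
  rw [Multiset.count_map, ← Multiset.countP_eq_card_filter]
  simp only [eq_comm (a := b)]
  rcases hO.cond b with h | h
  · have := h.1.1 K hK
    convert this.le
  · have := h.1.1 K hK
    convert this.le.trans zero_le_one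

end IsOccurrenceNet

theorem finite_postSet {C : Set E} (hC : C.Finite) : (O.postSet C).Finite := by
  classical
  refine (hC.biUnion fun e _ => ((O.post e).map Prod.fst).toFinset.finite_toSet).subset ?_
  rintro b ⟨e, he, hb⟩
  exact Set.mem_biUnion he (by simpa [produces_iff] using hb)

theorem finite_cut {C : Set E} (hC : C.Finite) : (O.cut C).Finite :=
  (finite_initConds.union (finite_postSet hC)).subset Set.sdiff_subset

theorem IsConfiguration.subset {C A : Set E} (hC : O.IsConfiguration C) (hAC : A ⊆ C)
    (hA : O.CausallyClosed A) : O.IsConfiguration A where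
  conflict_free e he e' he' := hC.conflict_free e (hAC he) e' (hAC he')
  color_free := by
    have h := hC.color_free
    rw [ColorConflict, not_not] at h ⊢
    obtain ⟨θ, hθ, -⟩ := h
    refine ⟨θ, ?_, ?_⟩
    · rintro e ⟨e', he', h⟩
      exact hθ e ⟨e', hAC he', h⟩
    · rintro b ⟨e', he', h⟩
      cases h
  causally_closed := hA

theorem IsConfiguration.eq_of_consumes {C : Set E} (hC : O.IsConfiguration C) {e e' : E} {b : B}
    (he : e ∈ C) (he' : e' ∈ C) (h : O.Consumes e b) (h' : O.Consumes e' b) : e = e' := by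
  by_contra hne
  exact hC.conflict_free e he e' he' ⟨b, e, e', hne, h, h', .refl, .refl⟩

/-- Absence of colour conflict only tests predicates of events in `C`; the initial predicate is read
off from one of them, hence the nonemptiness. -/
theorem IsConfiguration.exists_isInstantiation {C : Set E} (hC : O.IsConfiguration C)
    (hne : C.Nonempty) : ∃ θ, O.IsInstantiation C θ := by
  have h := hC.color_free
  rw [ColorConflict, not_not] at h
  obtain ⟨θ, hθ, -⟩ := h
  obtain ⟨e, he⟩ := hne
  exact ⟨θ, (hθ e ⟨e, he, rfl⟩).1, fun e he => hθ e ⟨e, he, rfl⟩⟩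

theorem IsInstantiation.subset {C A : Set E} {θ : IVar Var B E → Col}
    (h : O.IsInstantiation C θ) (hAC : A ⊆ C) : O.IsInstantiation A θ :=
  ⟨h.1, fun e he => h.2 e (hAC he)⟩

theorem IsInstantiation.locPred {C : Set E} {θ : IVar Var B E → Col}
    (h : O.IsInstantiation C θ) {e : E} (he : e ∈ C) : O.LocPred e θ :=
  (h.2 e he).2 e .refl

theorem isInstantiation_of_locPred {C : Set E} (hC : O.CausallyClosed C) {θ : IVar Var B E → Col}
    (h0 : O.PredBot θ) (h : ∀ e ∈ C, O.LocPred e θ) : O.IsInstantiation C θ :=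
  ⟨h0, fun e he => ⟨h0, fun e' he' => h e' (hC e he e' he')⟩⟩

/-- A finite nonempty causally closed set has an event whose removal leaves a causally closed
set. -/
theorem exists_causallyClosed_diff_singleton (hO : O.IsOccurrenceNet) {C : Set E}
    (hfin : C.Finite) (hne : C.Nonempty) (hC : O.CausallyClosed C) :
    ∃ e ∈ C, O.CausallyClosed (C \ {e}) := by
  let _ : Preorder E :=
    { le := fun a b => O.NodeLE (Sum.inr a) (Sum.inr b)
      le_refl := fun _ => .refl
      le_trans := fun _ _ _ h h' => Relation.ReflTransGen.trans h h' }
  -- A causally maximal event can be dropped, since no remaining event depends on it.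
  obtain ⟨e, he, hmax⟩ := hfin.exists_maximal hne
  refine ⟨e, he, fun e' he' e'' hle => ⟨hC e' he'.1 e'' hle, ?_⟩⟩
  rintro rfl
  rcases eq_or_nodeLT_of_nodeLE hle with h | h
  · exact he'.2 (Sum.inr_injective h).symm
  · exact hO.acyclic _ (Relation.TransGen.trans_left h (hmax he'.1 hle))

/-- A condition consumed by `e` is initial or produced in the strict past of `e`, so `A` supplies
it; conflict-freeness of `C` makes `e` its only consumer there, so `A` does not remove it. -/
theorem consumes_subset_cut (hO : O.IsOccurrenceNet) {C : Set E} (hC : O.IsConfiguration C)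
    {e : E} (he : e ∈ C) {A : Set E} (hAC : A ⊆ C) (heA : e ∉ A)
    (hA : ∀ e', O.NodeLT (Sum.inr e') (Sum.inr e) → e' ∈ A) {b : B} (hb : O.Consumes e b) :
    b ∈ O.cut A := by
  refine ⟨?_, ?_⟩
  · rcases hO.mem_initConds_or_produces b with h | ⟨e', he'⟩
    · exact Or.inl h
    · exact Or.inr ⟨e', hA e' (nodeLT_of_produces_of_consumes he' hb), he'⟩
  · rintro ⟨e', he', hb'⟩
    exact heA (hC.eq_of_consumes he (hAC he') hb hb' ▸ he')

end HLNet

/-! ### Represented markings are reachable; safety makes labels injective on cuts. -/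

open HLNet NetStructure

variable {Col Var P T B E : Type*} {N : HLNet Col Var P T} {O : HLNet Col Var B E}
  {hB : B → P} {hE : E → T}

namespace IsBranchingProcess

/-- Induction on the size, peeling off a causally maximal event `e`; it fires in `N` in the mode
that `θ` prescribes for the variables of `e`. -/
theorem reachable_mark (hO : IsBranchingProcess N O hB hE) {θ : IVar Var B E → Col} (n : ℕ) :
    ∀ C : Set E, C.Finite → C.ncard = n → O.IsConfiguration C → O.IsInstantiation C θ →
      N.Reachable (O.mark hB C θ) := by
  classical
  have hocc := hO.occurrence
  induction n with
  | zero =>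
    intro C hfin hn hC hθ
    rw [Set.ncard_eq_zero hfin] at hn
    subst hn
    obtain ⟨K, hK, hKθ⟩ := hθ.1
    have hcut : O.cut ∅ = {b | b ∈ K.map Prod.fst} := by
      ext b
      simp only [cut, postSet, preSet]
      simpa using mem_initConds_iff hK
    have hm : O.mark hB ∅ θ = K.map fun a => (hB a.1, a.2) := by
      rw [mark, hcut, finsum_mem_singleton_eq_map (hocc.nodup_init hK), Multiset.map_map]
      refine Multiset.map_congr rfl fun a ha => ?_
      have hb : a.1 ∈ O.initConds := ⟨K, hK, a.2, ha⟩
      simp [hocc.source_of_mem_initConds hb, hKθ a ha]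
    refine .init _ ?_
    rw [hm, ← hO.hom.init]
    exact ⟨K, hK, rfl⟩
  | succ n ih =>
    intro C hfin hn hC hθ
    have hne : C.Nonempty := (Set.ncard_pos hfin).1 (by omega)
    obtain ⟨e, he, hcl⟩ := exists_causallyClosed_diff_singleton hocc hfin hne hC.causally_closed
    set C' := C \ {e} with hC'
    have hsub : C' ⊆ C := Set.sdiff_subset
    have hfin' := hfin.subset hsub
    have hn' : C'.ncard = n := by
      have := Set.ncard_sdiff_singleton_add_one he hfin
      rw [hC']
      omega
    have hreach := ih C' hfin' hn' (hC.subset hsub hcl) (hθ.subset hsub)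
    have heC' : e ∉ C' := fun h => h.2 rfl
    have hCins : ∀ x, x ∈ C ↔ x ∈ C' ∨ x = e := by
      intro x
      by_cases hx : x = e
      · simp [hx, he]
      · simp [hC', hx]
    set f : B → P × Col := fun b => (hB b, θ (O.source b)) with hf
    have hloc := hθ.locPred he
    -- The local predicate of `e` equates the colours on its incoming arcs with the colours stored
    -- on the consumed conditions.
    have hpre : N.preMode (hE e) (fun x => θ (.ofEvent e x)) =
        ∑ᶠ b ∈ {b | b ∈ (O.pre e).map Prod.fst}, {f b} := by
      rw [finsum_mem_singleton_eq_map (hocc.ordinary e).1, preMode, hO.hom.pre, Multiset.map_map,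
        Multiset.map_map]
      exact Multiset.map_congr rfl fun a ha => by simp [hf, hloc.2 a ha]
    have hpost : N.postMode (hE e) (fun x => θ (.ofEvent e x)) =
        ∑ᶠ b ∈ {b | b ∈ (O.post e).map Prod.fst}, {f b} := by
      rw [finsum_mem_singleton_eq_map (hocc.ordinary e).2, postMode, hO.hom.post, Multiset.map_map,
        Multiset.map_map]
      exact Multiset.map_congr rfl fun a ha => by
        simp [hf, hocc.source_of_mem_post (b := a.1) (x := a.2) ha]
    set Pre : Set B := {b | b ∈ (O.pre e).map Prod.fst} with hPre
    set Post : Set B := {b | b ∈ (O.post e).map Prod.fst} with hPost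
    have hPref : Pre.Finite :=
      ((O.pre e).map Prod.fst).toFinset.finite_toSet.subset fun b hb =>
        Finset.mem_coe.2 (Multiset.mem_toFinset.2 hb)
    have hPostf : Post.Finite :=
      ((O.post e).map Prod.fst).toFinset.finite_toSet.subset fun b hb =>
        Finset.mem_coe.2 (Multiset.mem_toFinset.2 hb)
    have hmemPre : ∀ b, b ∈ Pre ↔ O.Consumes e b := fun b => consumes_iff.symm
    have hmemPost : ∀ b, b ∈ Post ↔ O.Produces e b := fun b => produces_iff.symm
    have hPresub : Pre ⊆ O.cut C' := fun b hb =>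
      consumes_subset_cut hocc hC he hsub heC' (fun e' he' =>
        ⟨hC.causally_closed e he e' he'.to_reflTransGen, by
          rintro rfl; exact hocc.acyclic _ he'⟩) ((hmemPre b).1 hb)
    have hcut : O.cut C = (O.cut C' \ Pre) ∪ Post := by
      ext b
      simp only [cut, Set.mem_sdiff, Set.mem_union, hmemPre, hmemPost, postSet, preSet,
        Set.mem_ofPred_eq, hCins]
      constructor
      · rintro ⟨h1, h2⟩
        have h3 : ¬ O.Consumes e b := fun h => h2 ⟨e, Or.inr rfl, h⟩
        rcases h1 with h1 | ⟨t, ht | rfl, h1⟩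
        · exact Or.inl ⟨⟨Or.inl h1, fun ⟨t, ht, h⟩ => h2 ⟨t, Or.inl ht, h⟩⟩, h3⟩
        · exact Or.inl ⟨⟨Or.inr ⟨t, ht, h1⟩, fun ⟨t, ht, h⟩ => h2 ⟨t, Or.inl ht, h⟩⟩, h3⟩
        · exact Or.inr h1
      · rintro (⟨⟨h1, h2⟩, h3⟩ | h)
        · refine ⟨?_, ?_⟩
          · rcases h1 with h1 | ⟨t, ht, h1⟩
            · exact Or.inl h1
            · exact Or.inr ⟨t, Or.inl ht, h1⟩
          · rintro ⟨t, ht | rfl, h⟩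
            · exact h2 ⟨t, ht, h⟩
            · exact h3 h
        · refine ⟨Or.inr ⟨e, Or.inr rfl, h⟩, ?_⟩
          rintro ⟨t, ht | rfl, h'⟩
          · exact heC' (hcl.mem_of_direct ht h h')
          · exact hocc.acyclic _ (nodeLT_of_produces_of_consumes h h')
    have hdisj : Disjoint (O.cut C' \ Pre) Post := by
      rw [Set.disjoint_left]
      rintro b ⟨⟨h1, -⟩, -⟩ hb
      rw [hmemPost] at hb
      rcases h1 with h1 | ⟨t, ht, h1⟩
      · exact hocc.not_produces_of_mem_initConds h1 e hb
      · exact heC' (hocc.produces_unique h1 hb ▸ ht)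
    have hfc : (O.cut C').Finite := finite_cut hfin'
    have hmC' : O.mark hB C' θ = ∑ᶠ b ∈ O.cut C' \ Pre, {f b} + ∑ᶠ b ∈ Pre, {f b} := by
      rw [← finsum_mem_union Set.disjoint_sdiff_left (hfc.subset Set.sdiff_subset) hPref,
        Set.sdiff_union_of_subset hPresub]
      rfl
    have hmC : O.mark hB C θ = ∑ᶠ b ∈ O.cut C' \ Pre, {f b} + ∑ᶠ b ∈ Post, {f b} := by
      rw [← finsum_mem_union hdisj (hfc.subset Set.sdiff_subset) hPostf, ← hcut]
      rfl
    refine .step _ _ (hE e) (fun x => θ (.ofEvent e x)) hreach ⟨?_, ?_, ?_⟩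
    · rw [← hO.hom.guard]
      exact hloc.1
    · rw [hpre, hmC']
      exact Multiset.le_add_left _ _
    · rw [hpre, hpost, hmC', hmC]
      congr 1
      convert Multiset.add_sub_cancel_right.symm

/-- Two equally labelled conditions of the cut would put two tokens on one place of a reachable
marking. -/
theorem injOn_cut (hO : IsBranchingProcess N O hB hE) (hN : N.Safe) {C : Set E} (hfin : C.Finite)
    (hC : O.IsConfiguration C) {θ : IVar Var B E → Col} (hθ : O.IsInstantiation C θ) :
    Set.InjOn hB (O.cut C) := by
  classical
  have h := hN _ (hO.reachable_mark _ C hfin rfl hC hθ)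
  exact injOn_of_countP_finsum_le_one (finite_cut hfin)
    (f := fun b => (hB b, θ (O.source b))) (g := Prod.fst) fun c => by
      convert h c
      rfl

end IsBranchingProcess

end HLPetri

/-! ### Sorted label sequences and well-foundedness by counting. -/

namespace HLPetri

/-- Equal length is essential: for `a < b < c`, the list `[a]` precedes `[a, b]`, but inserting `c`
yields `[a, c]` and `[a, b, c]`, in the opposite order. -/
theorem lex_orderedInsert {T : Type*} [LinearOrder T] (a : T) {l₁ l₂ : List T}
    (h : List.Lex (· < ·) l₁ l₂) (hlen : l₁.length = l₂.length) :
    List.Lex (· < ·) (l₁.orderedInsert (· ≤ ·) a) (l₂.orderedInsert (· ≤ ·) a) := by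
  induction h with
  | nil => simp at hlen
  | @cons x l₁ l₂ h ih =>
    simp only [List.orderedInsert]
    split_ifs
    · exact .cons (.cons h)
    · exact .cons (ih (by simpa using hlen))
  | @rel x l₁ y l₂ h =>
    simp only [List.orderedInsert]
    split_ifs with h1 h2 h2
    · exact .cons (.rel h)
    · exact absurd (h1.trans h.le) h2
    · exact .rel (not_le.1 h1)
    · exact .rel h

theorem sort_cons_eq_orderedInsert {T : Type*} [LinearOrder T] (a : T) (m : Multiset T) :
    (a ::ₘ m).sort (· ≤ ·) = (m.sort (· ≤ ·)).orderedInsert (· ≤ ·) a := by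
  refine List.Perm.eq_of_pairwise' (Multiset.pairwise_sort _ _)
    (List.Pairwise.orderedInsert a _ (Multiset.pairwise_sort _ _)) ?_
  rw [← Multiset.coe_eq_coe, Multiset.sort_eq, Multiset.coe_eq_coe.2 (List.perm_orderedInsert _ a _),
    ← Multiset.cons_coe, Multiset.sort_eq]

theorem lex_sort_add {T : Type*} [LinearOrder T] {m₁ m₂ : Multiset T}
    (h : List.Lex (· < ·) (m₁.sort (· ≤ ·)) (m₂.sort (· ≤ ·)))
    (hcard : m₁.card = m₂.card) (d : Multiset T) :
    List.Lex (· < ·) ((m₁ + d).sort (· ≤ ·)) ((m₂ + d).sort (· ≤ ·)) := by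
  induction d using Multiset.induction_on with
  | empty => simpa using h
  | cons a d ih =>
    rw [Multiset.add_cons, Multiset.add_cons, sort_cons_eq_orderedInsert,
      sort_cons_eq_orderedInsert]
    exact lex_orderedInsert a ih (by simp [hcard])

/-- Since length is compared first, the lexicographic comparison only concerns lists of equal
length, where adding common elements is harmless. -/
theorem shortlex_sort_add {T : Type*} [LinearOrder T] {m₁ m₂ : Multiset T}
    (h : List.Shortlex (· < ·) (m₁.sort (· ≤ ·)) (m₂.sort (· ≤ ·))) (d : Multiset T) :
    List.Shortlex (· < ·) ((m₁ + d).sort (· ≤ ·)) ((m₂ + d).sort (· ≤ ·)) := by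
  rw [List.shortlex_def] at h ⊢
  simp only [Multiset.length_sort, Multiset.card_add, Nat.add_lt_add_iff_right,
    Nat.add_right_cancel_iff] at h ⊢
  exact h.imp_right fun h => ⟨h.1, lex_sort_add h.2 h.1 d⟩

theorem eq_of_map_eq_map_of_injOn {α β : Type*} {f : α → β} {s : Set α} (hf : Set.InjOn f s)
    {m m' : Multiset α} (hm : ∀ a ∈ m, a ∈ s) (hm' : ∀ a ∈ m', a ∈ s)
    (h : m.map f = m'.map f) : m = m' := by
  rcases isEmpty_or_nonempty α with hα | hα
  · exact Subsingleton.elim _ _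
  have key : ∀ l : Multiset α, (∀ a ∈ l, a ∈ s) → (l.map f).map (Function.invFunOn f s) = l := by
    intro l hl
    rw [Multiset.map_map]
    conv_rhs => rw [← Multiset.map_id l]
    exact Multiset.map_congr rfl fun a ha => hf.leftInvOn_invFunOn (hl a ha)
  rw [← key m hm, h, key m' hm']

/-- The number of predecessors is finite and grows strictly along `r`, by transitivity and
irreflexivity. -/
theorem wellFounded_of_finite_size_le {α : Type*} {r : α → α → Prop} (irrefl : ∀ a, ¬ r a a)
    (trans : ∀ a b c, r a b → r b c → r a c) (size : α → ℕ) (h : ∀ a b, r a b → size a ≤ size b)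
    (hfin : ∀ n, {a | size a ≤ n}.Finite) : WellFounded r := by
  refine Subrelation.wf (r := InvImage (· < ·) fun a => {c | r c a}.ncard) ?_
    (InvImage.wf _ wellFounded_lt)
  intro a b hab
  refine Set.ncard_lt_ncard ⟨fun c hc => trans c a b hc hab, fun hsub => irrefl a (hsub hab)⟩
    ((hfin (size b)).subset fun c hc => h c b hc)

theorem finsum_mem_image_label {E T : Type*} {hE : E → T} {X : Set E} {f : E → E} (hf : Set.InjOn f X)
    (hlab : ∀ e ∈ X, hE (f e) = hE e) :
    ∑ᶠ e ∈ f '' X, ({hE e} : Multiset T) = ∑ᶠ e ∈ X, ({hE e} : Multiset T) := by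
  rw [finsum_mem_image hf]
  exact finsum_mem_congr rfl fun e he => by rw [hlab e he]

section Parikh

variable {E T : Type*} [LinearOrder T] {hE : E → T}

theorem length_parikh {X : Set E} (hX : X.Finite) : (parikh hE X).length = X.ncard := by
  have h := finsum_mem_singleton_eq_map hX.toFinset.nodup hE
  have hs' : {b | b ∈ hX.toFinset.val} = X := by ext; simp
  rw [hs'] at h
  rw [parikh, Multiset.length_sort, h, Multiset.card_map, Set.ncard_eq_toFinset_card X hX]
  rfl

theorem mem_parikh {X : Set E} (hX : X.Finite) {t : T} :
    t ∈ parikh hE X ↔ ∃ e ∈ X, hE e = t := by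
  rw [parikh, Multiset.mem_sort, mem_finsum_mem_singleton hX]

theorem parikh_eq_iff {X Y : Set E} : parikh hE X = parikh hE Y ↔
    ∑ᶠ e ∈ X, ({hE e} : Multiset T) = ∑ᶠ e ∈ Y, ({hE e} : Multiset T) := by
  constructor
  · intro h
    have := congrArg (fun l : List T => (l : Multiset T)) h
    simpa only [parikh, Multiset.sort_eq] using this
  · intro h
    rw [parikh, parikh, h]

theorem parikh_union {X Y : Set E} (h : Disjoint X Y) (hX : X.Finite) (hY : Y.Finite) :
    parikh hE (X ∪ Y) =
      (∑ᶠ e ∈ X, ({hE e} : Multiset T) + ∑ᶠ e ∈ Y, ({hE e} : Multiset T)).sort (· ≤ ·) := by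
  rw [parikh, finsum_mem_union h hX hY]

theorem nonempty_of_parikh_eq {X Y : Set E} (hX : X.Finite) (hY : Y.Finite)
    (h : parikh hE X = parikh hE Y) (hne : X.Nonempty) : Y.Nonempty := by
  obtain ⟨e, he⟩ := hne
  obtain ⟨e', he', -⟩ := (mem_parikh hY).1 (h ▸ (mem_parikh hX).2 ⟨e, he, rfl⟩)
  exact ⟨e', he'⟩

end Parikh

/-! ### Foata slices as levels of causal height. -/

namespace HLNet

open NetStructure

variable {Col Var B E : Type*} {O : HLNet Col Var B E}

/-- There is a causal chain of `n` events strictly below `e`. -/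
def HeightGE (O : HLNet Col Var B E) : ℕ → E → Prop
  | 0, _ => True
  | n + 1, e => ∃ e', O.NodeLT (Sum.inr e') (Sum.inr e) ∧ O.HeightGE n e'

theorem HeightGE.of_succ {n : ℕ} : ∀ {e : E}, O.HeightGE (n + 1) e → O.HeightGE n e := by
  induction n with
  | zero => exact fun _ => trivial
  | succ n ih => exact fun ⟨e', h, h'⟩ => ⟨e', h, ih h'⟩

theorem HeightGE.of_le {m n : ℕ} (hmn : m ≤ n) {e : E} (h : O.HeightGE n e) : O.HeightGE m e := by
  induction hmn with
  | refl => exact h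
  | step _ ih => exact ih h.of_succ

/-- The events of `C` with fewer than `n` events in every causal chain strictly below them. -/
def lowerPart (O : HLNet Col Var B E) (C : Set E) (n : ℕ) : Set E := {e ∈ C | ¬ O.HeightGE n e}

theorem lowerPart_subset {C : Set E} {n : ℕ} : O.lowerPart C n ⊆ C := fun _ h => h.1

theorem causallyClosed_lowerPart {C : Set E} (hC : O.CausallyClosed C) (n : ℕ) :
    O.CausallyClosed (O.lowerPart C n) := by
  refine fun e he e' hle => ⟨hC e he.1 e' hle, fun h => he.2 ?_⟩
  rcases eq_or_nodeLT_of_nodeLE hle with h' | h'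
  · cases h'
    exact h
  · exact HeightGE.of_succ ⟨e', h', h⟩

/-- In a causally closed set, height can be measured in the whole net. Slices thus depend on `C`
only through membership, which makes those of different configurations comparable. -/
theorem foataRest_eq {C : Set E} (hC : O.CausallyClosed C) (n : ℕ) :
    O.foataRest C n = {e ∈ C | O.HeightGE n e} := by
  induction n with
  | zero => simp [foataRest, HeightGE]
  | succ n ih =>
    ext e
    simp only [foataRest, ih, minEvents, Set.mem_sdiff, Set.mem_ofPred_eq]
    constructor
    · rintro ⟨h, h'⟩
      refine ⟨h.1, ?_⟩
      by_contra hn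
      exact h' ⟨h, fun e' he' hlt => hn ⟨e', hlt, he'.2⟩⟩
    · rintro ⟨h, h'⟩
      refine ⟨⟨h, h'.of_succ⟩, fun hmin => ?_⟩
      obtain ⟨e', hlt, he'⟩ := h'
      exact hmin.2 e' ⟨hC.mem_of_lt h hlt, he'⟩ hlt

theorem mem_foataSlice_iff {C : Set E} (hC : O.CausallyClosed C) {n : ℕ} {e : E} :
    e ∈ O.foataSlice C n ↔ e ∈ C ∧ O.HeightGE n e ∧ ¬ O.HeightGE (n + 1) e := by
  rw [foataSlice, foataRest_eq hC]
  simp only [minEvents, Set.mem_ofPred_eq]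
  constructor
  · rintro ⟨h, h'⟩
    exact ⟨h.1, h.2, fun ⟨e', hlt, he'⟩ => h' e' ⟨hC.mem_of_lt h.1 hlt, he'⟩ hlt⟩
  · rintro ⟨h, h1, h2⟩
    exact ⟨⟨h, h1⟩, fun e' he' hlt => h2 ⟨e', hlt, he'.2⟩⟩

theorem foataSlice_subset {C : Set E} (hC : O.CausallyClosed C) (n : ℕ) :
    O.foataSlice C n ⊆ C := fun _ h => ((mem_foataSlice_iff hC).1 h).1

theorem exists_mem_foataSlice {C : Set E} (hC : O.CausallyClosed C) {n : ℕ} {e : E} (he : e ∈ C)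
    (hn : ¬ O.HeightGE n e) : ∃ j < n, e ∈ O.foataSlice C j := by
  induction n with
  | zero => exact absurd trivial hn
  | succ n ih =>
    by_cases h : O.HeightGE n e
    · exact ⟨n, n.lt_succ_self, (mem_foataSlice_iff hC).2 ⟨he, h, hn⟩⟩
    · obtain ⟨j, hj, h⟩ := ih h
      exact ⟨j, hj.trans n.lt_succ_self, h⟩

/-- While the height exceeds `n`, pass to a lower event whose height is still at least `n`;
well-foundedness stops the descent at height exactly `n`. -/
theorem foataSlice_nonempty (hO : O.IsOccurrenceNet) {C : Set E} (hC : O.CausallyClosed C)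
    {n : ℕ} {e : E} (he : e ∈ C) (hn : O.HeightGE n e) : (O.foataSlice C n).Nonempty := by
  have hwf : WellFounded fun e e' : E => O.NodeLT (Sum.inr e) (Sum.inr e') :=
    InvImage.wf Sum.inr hO.wellFounded
  induction e using hwf.induction with
  | _ e ih =>
    by_cases h : O.HeightGE (n + 1) e
    · obtain ⟨e', hlt, h'⟩ := h
      exact ih e' hlt (hC.mem_of_lt he hlt) h'
    · exact ⟨e, (mem_foataSlice_iff hC).2 ⟨he, hn, h⟩⟩

theorem lowerPart_eq_of_foataSlice_eq {C₁ C₂ : Set E} (hC₁ : O.CausallyClosed C₁)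
    (hC₂ : O.CausallyClosed C₂) {n : ℕ} (h : ∀ j < n, O.foataSlice C₁ j = O.foataSlice C₂ j) :
    O.lowerPart C₁ n = O.lowerPart C₂ n := by
  ext e
  constructor <;> rintro ⟨he, hn⟩
  · obtain ⟨j, hj, hm⟩ := exists_mem_foataSlice hC₁ he hn
    exact ⟨foataSlice_subset hC₂ j (h j hj ▸ hm), hn⟩
  · obtain ⟨j, hj, hm⟩ := exists_mem_foataSlice hC₂ he hn
    exact ⟨foataSlice_subset hC₁ j (h j hj ▸ hm), hn⟩

/-- A chain of `n` events strictly below `e`, together with `e`, gives more than `n` events in its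
past, all of them in `C`. -/
theorem not_heightGE_ncard (hO : O.IsOccurrenceNet) {C : Set E} (hfin : C.Finite)
    (hC : O.CausallyClosed C) {e : E} (he : e ∈ C) : ¬ O.HeightGE C.ncard e := by
  have key : ∀ n, ∀ e ∈ C, O.HeightGE n e →
      n < {e' | O.NodeLE (Sum.inr e') (Sum.inr e)}.ncard := by
    intro n
    induction n with
    | zero =>
      intro e he _
      exact (Set.ncard_pos (hfin.subset (hC e he))).2 ⟨e, .refl⟩
    | succ n ih =>
      rintro e he ⟨e', hlt, h'⟩
      refine lt_of_le_of_lt (Nat.succ_le_of_lt (ih e' (hC.mem_of_lt he hlt) h'))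
        (Set.ncard_lt_ncard ⟨fun x hx => Relation.ReflTransGen.trans hx hlt.to_reflTransGen,
          fun hsub => ?_⟩ (hfin.subset (hC e he)))
      exact hO.acyclic _ (Relation.TransGen.trans_left hlt (hsub (.refl : O.NodeLE _ _)))
  exact fun h => absurd (key _ e he h) (Set.ncard_le_ncard (hC e he) hfin).not_gt

theorem lowerPart_eq_self (hO : O.IsOccurrenceNet) {C : Set E} (hfin : C.Finite)
    (hC : O.CausallyClosed C) {n : ℕ} (hn : C.ncard ≤ n) : O.lowerPart C n = C :=
  Set.Subset.antisymm lowerPart_subset fun _ he =>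
    ⟨he, fun h => not_heightGE_ncard hO hfin hC he (h.of_le hn)⟩

theorem consumes_subset_cut_lowerPart (hO : O.IsOccurrenceNet) {C : Set E}
    (hC : O.IsConfiguration C) {n : ℕ} {e : E} (he : e ∈ O.foataSlice C n) {b : B}
    (hb : O.Consumes e b) : b ∈ O.cut (O.lowerPart C n) := by
  obtain ⟨h, h1, h2⟩ := (mem_foataSlice_iff hC.causally_closed).1 he
  exact consumes_subset_cut hO hC h lowerPart_subset (fun h => h.2 h1)
    (fun e' hlt => ⟨CausallyClosed.mem_of_lt hC.causally_closed h hlt, fun h => h2 ⟨e', hlt, h⟩⟩) hb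

end HLNet

/-! ### Slice labels determine a configuration; finiteness and totality. -/

open HLNet NetStructure

variable {Col Var P T B E : Type*} {N : HLNet Col Var P T} {O : HLNet Col Var B E}
  {hB : B → P} {hE : E → T}

namespace IsBranchingProcess

/-- The incoming arcs of both events map to those of one transition; injectivity on `S` makes the
arcs themselves equal, and a branching process has no duplicate events. -/
theorem eq_of_consumes_mem (hO : IsBranchingProcess N O hB hE) {S : Set B} (hS : Set.InjOn hB S)
    {e e' : E} (he : ∀ b, O.Consumes e b → b ∈ S) (he' : ∀ b, O.Consumes e' b → b ∈ S)
    (h : hE e = hE e') : e = e' := by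
  refine hO.inj e e' ?_ h
  refine eq_of_map_eq_map_of_injOn (f := fun a : B × Var => (hB a.1, a.2))
    (s := {a | a.1 ∈ S}) ?_ (fun a ha => he a.1 ⟨a.2, ha⟩) (fun a ha => he' a.1 ⟨a.2, ha⟩) ?_
  · rintro ⟨a, x⟩ ha ⟨b, y⟩ hb hab
    simp only [Prod.mk.injEq] at hab
    exact Prod.ext (hS ha hb hab.1) hab.2
  · rw [← hO.hom.pre, ← hO.hom.pre, h]

variable [LinearOrder T]

/-- An event has an equally labelled partner in the other slice, and both consume from the cut of
the common lower part, where labels are injective. -/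
theorem foataSlice_subset_of_parikh_eq (hO : IsBranchingProcess N O hB hE) (hN : N.Safe)
    {C₁ C₂ : Set E} (hC₁ : O.IsConfiguration C₁) (hC₂ : O.IsConfiguration C₂)
    (hfin₁ : C₁.Finite) (hfin₂ : C₂.Finite) {n : ℕ}
    (hlow : O.lowerPart C₁ n = O.lowerPart C₂ n)
    (h : parikh hE (O.foataSlice C₁ n) = parikh hE (O.foataSlice C₂ n)) :
    O.foataSlice C₁ n ⊆ O.foataSlice C₂ n := by
  intro e he
  have hs₁ := foataSlice_subset hC₁.causally_closed n
  have hs₂ := foataSlice_subset hC₂.causally_closed n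
  obtain ⟨e', he', hlab⟩ := (mem_parikh (hfin₂.subset hs₂)).1
    (h ▸ (mem_parikh (hfin₁.subset hs₁)).2 ⟨e, he, rfl⟩)
  obtain ⟨θ, hθ⟩ := hC₁.exists_isInstantiation ⟨e, hs₁ he⟩
  have hinj := hO.injOn_cut hN (hfin₁.subset (lowerPart_subset (O := O) (n := n)))
    (hC₁.subset lowerPart_subset (causallyClosed_lowerPart hC₁.causally_closed n))
    (hθ.subset lowerPart_subset)
  rwa [hO.eq_of_consumes_mem hinj
    (fun b hb => consumes_subset_cut_lowerPart hO.occurrence hC₁ he hb)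
    (fun b hb => hlow ▸ consumes_subset_cut_lowerPart hO.occurrence hC₂ he' hb) hlab.symm]

theorem foataSlice_eq_of_parikh_eq (hO : IsBranchingProcess N O hB hE) (hN : N.Safe)
    {C₁ C₂ : Set E} (hC₁ : O.IsConfiguration C₁) (hC₂ : O.IsConfiguration C₂)
    (hfin₁ : C₁.Finite) (hfin₂ : C₂.Finite) {n : ℕ}
    (h : ∀ j < n, parikh hE (O.foataSlice C₁ j) = parikh hE (O.foataSlice C₂ j)) :
    ∀ j < n, O.foataSlice C₁ j = O.foataSlice C₂ j := by
  intro j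
  induction j using Nat.strong_induction_on with
  | _ j ih =>
    intro hj
    have hlow := lowerPart_eq_of_foataSlice_eq hC₁.causally_closed hC₂.causally_closed
      fun k hk => ih k hk (hk.trans hj)
    exact Set.Subset.antisymm
      (hO.foataSlice_subset_of_parikh_eq hN hC₁ hC₂ hfin₁ hfin₂ hlow (h j hj))
      (hO.foataSlice_subset_of_parikh_eq hN hC₂ hC₁ hfin₂ hfin₁ hlow.symm (h j hj).symm)

theorem lowerPart_eq_of_parikh_eq (hO : IsBranchingProcess N O hB hE) (hN : N.Safe)
    {C₁ C₂ : Set E} (hC₁ : O.IsConfiguration C₁) (hC₂ : O.IsConfiguration C₂)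
    (hfin₁ : C₁.Finite) (hfin₂ : C₂.Finite) {n : ℕ}
    (h : ∀ j < n, parikh hE (O.foataSlice C₁ j) = parikh hE (O.foataSlice C₂ j)) :
    O.lowerPart C₁ n = O.lowerPart C₂ n :=
  lowerPart_eq_of_foataSlice_eq hC₁.causally_closed hC₂.causally_closed
    (hO.foataSlice_eq_of_parikh_eq hN hC₁ hC₂ hfin₁ hfin₂ h)

theorem eq_of_parikh_foataSlice_eq (hO : IsBranchingProcess N O hB hE) (hN : N.Safe)
    {C₁ C₂ : O.FinConfig} {n : ℕ} (h₁ : C₁.1.ncard ≤ n) (h₂ : C₂.1.ncard ≤ n)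
    (h : ∀ j < n, parikh hE (O.foataSlice C₁.1 j) = parikh hE (O.foataSlice C₂.1 j)) :
    C₁ = C₂ := by
  refine Subtype.ext ?_
  have := hO.lowerPart_eq_of_parikh_eq hN C₁.2.1 C₂.2.1 C₁.2.2 C₂.2.2 h
  rwa [lowerPart_eq_self hO.occurrence C₁.2.2 C₁.2.1.causally_closed h₁,
    lowerPart_eq_self hO.occurrence C₂.2.2 C₂.2.1.causally_closed h₂] at this

/-- Such a configuration is determined by the label sequences of its first `n` slices, which are
lists of length at most `n` over the finite type `T`. -/
theorem finite_finConfig_ncard_le [Finite T] (hO : IsBranchingProcess N O hB hE) (hN : N.Safe)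
    (n : ℕ) : {C : O.FinConfig | C.1.ncard ≤ n}.Finite := by
  refine Set.Finite.of_finite_image
    (f := fun C => fun i : Fin n => parikh hE (O.foataSlice C.1 i)) ?_ ?_
  · refine (Set.Finite.pi' fun _ : Fin n => List.finite_length_le T n).subset ?_
    rintro _ ⟨C, hC, rfl⟩ i
    have hs := foataSlice_subset (O := O) C.2.1.causally_closed i
    have := length_parikh (hE := hE) (C.2.2.subset hs)
    exact this.le.trans ((Set.ncard_le_ncard hs C.2.2).trans hC)
  · intro C₁ h₁ C₂ h₂ h
    exact hO.eq_of_parikh_foataSlice_eq hN h₁ h₂ fun j hj => congrFun h ⟨j, hj⟩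

theorem foataOrder_trichotomous (hO : IsBranchingProcess N O hB hE) (hN : N.Safe)
    (C₁ C₂ : O.FinConfig) :
    O.foataOrder hE C₁ C₂ ∨ C₁ = C₂ ∨ O.foataOrder hE C₂ C₁ := by
  rcases lt_trichotomy C₁.1.ncard C₂.1.ncard with hlt | hcard | hlt
  · exact Or.inl (Or.inl hlt)
  · have hL : ∀ l l' : List T, List.Lex (· < ·) l l' ∨ l = l' ∨ List.Lex (· < ·) l' l :=
      fun l l' => trichotomous_of _ l l'
    have hS : ∀ l l' : List T, List.Shortlex (· < ·) l l' ∨ l = l' ∨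
      List.Shortlex (· < ·) l' l := fun l l' => trichotomous_of _ l l'
    rcases hL (parikh hE C₁.1) (parikh hE C₂.1) with h | hpar | h
    · exact Or.inl (Or.inr (Or.inl ⟨hcard, h⟩))
    · by_cases heq : C₁ = C₂
      · exact Or.inr (Or.inl heq)
      have hex : ∃ n, parikh hE (O.foataSlice C₁.1 n) ≠ parikh hE (O.foataSlice C₂.1 n) := by
        by_contra! hall
        exact heq (hO.eq_of_parikh_foataSlice_eq hN le_rfl hcard.ge fun j _ => hall j)
      classical
      have hn := Nat.find_spec hex
      have hmin : ∀ j < Nat.find hex,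
          parikh hE (O.foataSlice C₁.1 j) = parikh hE (O.foataSlice C₂.1 j) :=
        fun j hj => not_not.1 (Nat.find_min hex hj)
      generalize Nat.find hex = n at hn hmin
      have hlow := hO.lowerPart_eq_of_parikh_eq hN C₁.2.1 C₂.2.1 C₁.2.2 C₂.2.2 hmin
      -- At the first difference neither slice is empty: otherwise one configuration lies wholly in
      -- the common lower part, hence inside the other, and equal sizes make them equal.
      have key : ∀ C C' : O.FinConfig, O.lowerPart C.1 n = O.lowerPart C'.1 n →
          C.1.ncard = C'.1.ncard → parikh hE (O.foataSlice C.1 n) ≠ parikh hE (O.foataSlice C'.1 n) →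
          (O.foataSlice C.1 n).Nonempty := by
        intro C C' hl hc hne
        by_contra hemp
        rw [Set.not_nonempty_iff_eq_empty] at hemp
        have hle : C.1 ⊆ C'.1 := by
          intro e he
          have : e ∈ O.lowerPart C.1 n := ⟨he, fun hge =>
            (foataSlice_nonempty hO.occurrence C.2.1.causally_closed he hge).ne_empty hemp⟩
          rw [hl] at this
          exact this.1
        have := Set.eq_of_subset_of_ncard_le hle hc.ge C'.2.2
        exact hne (by rw [this])
      have hne₁ := key C₁ C₂ hlow hcard hn
      have hne₂ := key C₂ C₁ hlow.symm hcard.symm hn.symm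
      rcases hS (parikh hE (O.foataSlice C₁.1 n)) (parikh hE (O.foataSlice C₂.1 n)) with h | h | h
      · exact Or.inl (Or.inr (Or.inr ⟨hpar, n, hne₁, hne₂, hmin, h⟩))
      · exact absurd h hn
      · exact Or.inr (Or.inr (Or.inr (Or.inr ⟨hpar.symm, n, hne₂, hne₁,
          fun j hj => (hmin j hj).symm, h⟩)))
    · exact Or.inr (Or.inr (Or.inr (Or.inl ⟨hcard.symm, h⟩)))
  · exact Or.inr (Or.inr (Or.inl hlt))

end IsBranchingProcess

end HLPetri

/-! ### Transporting a suffix from one configuration to another. -/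

namespace HLPetri

theorem eq_of_filter_eq_of_card_le {α : Type*} {m m' : Multiset α} {p : α → Prop}
    [DecidablePred p] (h : m.filter p = m') (hcard : m.card ≤ m'.card) : m = m' := by
  rw [← h]
  exact (Multiset.eq_of_le_of_card_le (Multiset.filter_le p m) (h ▸ hcard)).symm

namespace HLNet

open NetStructure

variable {Col Var P T B E : Type*}

/-- `(fB, fE)` preserves labels, maps the events of `D` with all their arcs, and maps the cut of
`C₁` into the cut of `C₂`. -/
structure IsSuffixHom (O : HLNet Col Var B E) (hB : B → P) (hE : E → T) (C₁ D C₂ : Set E)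
    (fB : B → B) (fE : E → E) : Prop where
  cut : Set.MapsTo fB (O.cut C₁) (O.cut C₂)
  pre : ∀ e ∈ D, O.pre (fE e) = (O.pre e).map fun a => (fB a.1, a.2)
  post : ∀ e ∈ D, O.post (fE e) = (O.post e).map fun a => (fB a.1, a.2)
  label_conds : ∀ b ∈ O.cut C₁ ∪ O.postSet D, hB (fB b) = hB b
  label_events : ∀ e ∈ D, hE (fE e) = hE e

variable {O : HLNet Col Var B E} {hB : B → P} {hE : E → T} {C₁ D C₂ : Set E}
  {fB : B → B} {fE : E → E}

theorem mem_cut_or_mem_postSet (hO : O.IsOccurrenceNet) (hC : O.IsConfiguration (C₁ ∪ D))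
    (hd : Disjoint C₁ D) {e : E} (he : e ∈ D) {b : B} (hb : O.Consumes e b) :
    b ∈ O.cut C₁ ∨ b ∈ O.postSet D := by
  have hn : b ∉ O.preSet C₁ := fun ⟨e', he', hb'⟩ => by
    have := hC.eq_of_consumes (Or.inl he') (Or.inr he) hb' hb
    exact Set.disjoint_left.1 hd he' (this ▸ he)
  rcases hO.mem_initConds_or_produces b with h | ⟨e', h⟩
  · exact Or.inl ⟨Or.inl h, hn⟩
  · rcases CausallyClosed.mem_of_direct hC.causally_closed (Or.inr he) h hb with h' | h'
    · exact Or.inl ⟨Or.inr ⟨e', h', h⟩, hn⟩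
    · exact Or.inr ⟨e', h', h⟩

namespace IsSuffixHom

theorem consumes (h : O.IsSuffixHom hB hE C₁ D C₂ fB fE) {e : E} (he : e ∈ D) {b : B}
    (hb : O.Consumes (fE e) b) : ∃ b', O.Consumes e b' ∧ fB b' = b := by
  obtain ⟨x, hx⟩ := hb
  rw [h.pre e he] at hx
  obtain ⟨⟨b', y⟩, hy, heq⟩ := Multiset.mem_map.1 hx
  exact ⟨b', ⟨y, hy⟩, congrArg Prod.fst heq⟩

theorem produces (h : O.IsSuffixHom hB hE C₁ D C₂ fB fE) {e : E} (he : e ∈ D) {b : B}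
    (hb : O.Produces (fE e) b) : ∃ b', O.Produces e b' ∧ fB b' = b := by
  obtain ⟨x, hx⟩ := hb
  rw [h.post e he] at hx
  obtain ⟨⟨b', y⟩, hy, heq⟩ := Multiset.mem_map.1 hx
  exact ⟨b', ⟨y, hy⟩, congrArg Prod.fst heq⟩

theorem mem_post (h : O.IsSuffixHom hB hE C₁ D C₂ fB fE) {e : E} (he : e ∈ D) {a : B × Var}
    (ha : a ∈ O.post e) : (fB a.1, a.2) ∈ O.post (fE e) := by
  rw [h.post e he]
  exact Multiset.mem_map_of_mem (fun a : B × Var => (fB a.1, a.2)) ha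

end IsSuffixHom

end HLNet

open HLNet NetStructure

variable {Col Var P T B E : Type*} {N : HLNet Col Var P T} {O : HLNet Col Var B E}
  {hB : B → P} {hE : E → T} {C₁ D C₂ : Set E} {fB : B → B} {fE : E → E}

namespace IsBranchingProcess

theorem card_pre_eq (hO : IsBranchingProcess N O hB hE) {e e' : E} (h : hE e' = hE e) :
    (O.pre e').card = (O.pre e).card := by
  have h1 := congrArg Multiset.card (hO.hom.pre e)
  have h2 := congrArg Multiset.card (hO.hom.pre e')
  rw [h] at h2
  simpa using h2.symm.trans h1

theorem card_post_eq (hO : IsBranchingProcess N O hB hE) {e e' : E} (h : hE e' = hE e) :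
    (O.post e').card = (O.post e).card := by
  have h1 := congrArg Multiset.card (hO.hom.post e)
  have h2 := congrArg Multiset.card (hO.hom.post e')
  rw [h] at h2
  simpa using h2.symm.trans h1

-- The monomorphism only compares arcs within the subnets. The label of an event fixes its number of
-- arcs, so the filter cannot have discarded any.
open Classical in
theorem isSuffixHom (hO : IsBranchingProcess N O hB hE)
    (h : O.IsExtMono hB hE C₁ D C₂ fB fE) : O.IsSuffixHom hB hE C₁ D C₂ fB fE where
  cut b hb := h.image_cut ▸ Set.mem_image_of_mem fB hb
  pre e he := by
    have hall : ∀ a ∈ O.pre e, a.1 ∈ O.aroundConds C₁ D := fun a ha =>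
      Or.inl (Or.inr ⟨e, he, a.2, ha⟩)
    have hp := h.pre e he
    rw [Multiset.filter_eq_self.2 hall] at hp
    exact eq_of_filter_eq_of_card_le hp
      (by rw [Multiset.card_map, hO.card_pre_eq (h.label_events e he)])
  post e he := by
    have hall : ∀ a ∈ O.post e, a.1 ∈ O.aroundConds C₁ D := fun a ha =>
      Or.inr ⟨e, he, a.2, ha⟩
    have hp := h.post e he
    rw [Multiset.filter_eq_self.2 hall] at hp
    exact eq_of_filter_eq_of_card_le hp
      (by rw [Multiset.card_map, hO.card_post_eq (h.label_events e he)])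
  label_conds b hb := h.label_conds b (hb.imp_left Or.inl)
  label_events := h.label_events

/-- Allows `suffixHom_eq_self` to be applied with the two configurations exchanged. -/
theorem isSuffixHom_inverse (hO : IsBranchingProcess N O hB hE) [Nonempty B] [Nonempty E]
    (h : O.IsExtMono hB hE C₁ D C₂ fB fE) :
    O.IsSuffixHom hB hE C₂ (fE '' D) C₁ (Function.invFunOn fB (O.aroundConds C₁ D))
      (Function.invFunOn fE D) := by
  have hs := hO.isSuffixHom h
  have hgB : ∀ b ∈ O.aroundConds C₁ D, Function.invFunOn fB (O.aroundConds C₁ D) (fB b) = b :=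
    fun b hb => h.injOn_conds.leftInvOn_invFunOn hb
  have hgE : ∀ e ∈ D, Function.invFunOn fE D (fE e) = e :=
    fun e he => h.injOn_events.leftInvOn_invFunOn he
  constructor
  · intro b hb
    rw [← h.image_cut] at hb
    obtain ⟨b, hb, rfl⟩ := hb
    rwa [hgB b (Or.inl (Or.inl hb))]
  · rintro _ ⟨e, he, rfl⟩
    rw [hgE e he, hs.pre e he, Multiset.map_map]
    conv_lhs => rw [← Multiset.map_id (O.pre e)]
    exact Multiset.map_congr rfl fun a ha =>
      Prod.ext (hgB a.1 (Or.inl (Or.inr ⟨e, he, a.2, ha⟩))).symm rfl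
  · rintro _ ⟨e, he, rfl⟩
    rw [hgE e he, hs.post e he, Multiset.map_map]
    conv_lhs => rw [← Multiset.map_id (O.post e)]
    exact Multiset.map_congr rfl fun a ha =>
      Prod.ext (hgB a.1 (Or.inr ⟨e, he, a.2, ha⟩)).symm rfl
  · have key : ∀ b ∈ O.aroundConds C₁ D,
        hB (Function.invFunOn fB (O.aroundConds C₁ D) (fB b)) = hB (fB b) := fun b hb => by
      rw [hgB b hb, h.label_conds b hb]
    rintro b (hb | ⟨_, ⟨e, he, rfl⟩, hb⟩)
    · rw [← h.image_cut] at hb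
      obtain ⟨b, hb, rfl⟩ := hb
      exact key b (Or.inl (Or.inl hb))
    · obtain ⟨b', hb', rfl⟩ := hs.produces he hb
      exact key b' (Or.inr ⟨e, he, hb'⟩)
  · rintro _ ⟨e, he, rfl⟩
    rw [hgE e he, h.label_events e he]

theorem causallyClosed_extension (hO : IsBranchingProcess N O hB hE)
    (hC : O.IsConfiguration (C₁ ∪ D)) (hd : Disjoint C₁ D) (hC₂ : O.IsConfiguration C₂)
    (h : O.IsSuffixHom hB hE C₁ D C₂ fB fE) : O.CausallyClosed (C₂ ∪ fE '' D) := by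
  have hocc := hO.occurrence
  refine causallyClosed_of_direct ?_
  rintro _ (he | ⟨e, he, rfl⟩) e' b hp hc
  · exact Or.inl (CausallyClosed.mem_of_direct hC₂.causally_closed he hp hc)
  · obtain ⟨b, hb, rfl⟩ := h.consumes he hc
    rcases mem_cut_or_mem_postSet hocc hC hd he hb with hb' | ⟨e₀, he₀, x, hx⟩
    · rcases (h.cut hb').1 with hi | ⟨e₁, he₁, hp₁⟩
      · exact absurd hp (hocc.not_produces_of_mem_initConds hi e')
      · exact Or.inl (hocc.produces_unique hp hp₁ ▸ he₁)
    · exact Or.inr ⟨e₀, he₀, hocc.produces_unique ⟨x, h.mem_post he₀ hx⟩ hp⟩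

theorem disjoint_extension (h : O.IsExtMono hB hE C₁ D C₂ fB fE) : Disjoint C₂ (fE '' D) := by
  rw [Set.disjoint_left]
  rintro _ he ⟨e, heD, rfl⟩
  exact (h.mapsTo_events heD).1 (Or.inr ⟨_, he, rfl⟩)

theorem exists_isInstantiation_extension (hO : IsBranchingProcess N O hB hE) (hN : N.Safe)
    (hC : O.IsConfiguration (C₁ ∪ D)) (hfin₁ : C₁.Finite) (hfin₂ : C₂.Finite)
    (hd : Disjoint C₁ D) (hC₂ : O.IsConfiguration C₂)
    (h : O.IsExtMono hB hE C₁ D C₂ fB fE) {θ θ₂ : IVar Var B E → Col}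
    (hθ : O.IsInstantiation (C₁ ∪ D) θ) (hθ₂ : O.IsInstantiation C₂ θ₂)
    (hmark : O.mark hB C₁ θ = O.mark hB C₂ θ₂) :
    ∃ θ', O.IsInstantiation (C₂ ∪ fE '' D) θ' := by
  classical
  have hocc := hO.occurrence
  have hs := hO.isSuffixHom h
  have hdisj := disjoint_extension h
  have hinj := hO.injOn_cut hN hfin₂ hC₂ hθ₂
  -- Glue: `θ`, transported along `fE`, on the image of `D`, and `θ₂` elsewhere, in particular on
  -- the initial variables.
  let θ' : IVar Var B E → Col := fun v =>
    match v with
    | .ofBot b => θ₂ (.ofBot b)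
    | .ofEvent e x => if h : ∃ e₀ ∈ D, fE e₀ = e then θ (.ofEvent h.choose x) else θ₂ (.ofEvent e x)
  have hnew : ∀ e ∈ D, ∀ x, θ' (.ofEvent (fE e) x) = θ (.ofEvent e x) := by
    intro e he x
    have hex : ∃ e₀ ∈ D, fE e₀ = fE e := ⟨e, he, rfl⟩
    change dite _ _ _ = _
    rw [dif_pos hex, h.injOn_events hex.choose_spec.1 he hex.choose_spec.2]
  have hold : ∀ e ∈ C₂, ∀ x, θ' (.ofEvent e x) = θ₂ (.ofEvent e x) := by
    intro e he x
    change dite _ _ _ = _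
    rw [dif_neg]
    exact fun hex => Set.disjoint_left.1 hdisj he hex
  have hsource : ∀ b, (∀ e, O.Produces e b → e ∈ C₂) → θ' (O.source b) = θ₂ (O.source b) := by
    intro b hb
    rcases hocc.mem_initConds_or_produces b with hi | ⟨e, x, hx⟩
    · rw [hocc.source_of_mem_initConds hi]
    · rw [hocc.source_of_mem_post hx, hold e (hb e ⟨x, hx⟩)]
  -- Equal markings provide a condition in the cut of `C₂` with the label and the colour of `b`;
  -- injectivity of labels there identifies it with `fB b`.
  have hcut : ∀ b ∈ O.cut C₁, θ' (O.source (fB b)) = θ (O.source b) := by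
    intro b hb
    rw [hsource]
    · have hm : (hB b, θ (O.source b)) ∈ O.mark hB C₂ θ₂ := by
        rw [← hmark]
        exact (mem_finsum_mem_singleton (finite_cut hfin₁) _).2 ⟨b, hb, rfl⟩
      obtain ⟨b', hb', heq⟩ := (mem_finsum_mem_singleton (finite_cut hfin₂) _).1 hm
      rw [Prod.mk.injEq] at heq
      rw [← heq.2, hinj hb' (hs.cut hb) (heq.1.trans (hs.label_conds b (Or.inl hb)).symm)]
    · intro e he
      rcases (hs.cut hb).1 with hi | ⟨e', he', hp⟩
      · exact absurd he (hocc.not_produces_of_mem_initConds hi e)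
      · exact hocc.produces_unique he hp ▸ he'
  refine ⟨θ', isInstantiation_of_locPred (hO.causallyClosed_extension hC hd hC₂ hs) hθ₂.1 ?_⟩
  rintro _ (he | ⟨e, he, rfl⟩)
  · rename_i e
    obtain ⟨hg, hp⟩ := hθ₂.locPred he
    refine ⟨by simpa only [hold e he] using hg, fun a ha => ?_⟩
    rw [hold e he, hp a ha, hsource]
    exact fun e' he' => CausallyClosed.mem_of_direct hC₂.causally_closed he he' ⟨a.2, ha⟩
  · obtain ⟨hg, hp⟩ := hθ.locPred (Or.inr he : e ∈ C₁ ∪ D)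
    refine ⟨?_, ?_⟩
    · rw [← h.guard e he]
      simpa only [hnew e he] using hg
    · intro a ha
      rw [hs.pre e he] at ha
      obtain ⟨a, ha', rfl⟩ := Multiset.mem_map.1 ha
      rw [hnew e he, hp a ha']
      rcases mem_cut_or_mem_postSet hocc hC hd he ⟨a.2, ha'⟩ with hb | ⟨e₀, he₀, x, hx⟩
      · exact (hcut _ hb).symm
      · rw [hocc.source_of_mem_post hx, hocc.source_of_mem_post (hs.mem_post he₀ hx), hnew e₀ he₀]

/-- A structural conflict comes down to two distinct events of the union consuming one condition.
Within `C₂` this is impossible, a mixed pair contradicts membership in the future of `C₂`, and two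
images pull back along the injective `fB` to a conflict in `D`. -/
theorem isConfiguration_extension (hO : IsBranchingProcess N O hB hE) (hN : N.Safe)
    (hC : O.IsConfiguration (C₁ ∪ D)) (hfin₁ : C₁.Finite) (hfin₂ : C₂.Finite)
    (hd : Disjoint C₁ D) (hC₂ : O.IsConfiguration C₂)
    (h : O.IsExtMono hB hE C₁ D C₂ fB fE) {θ θ₂ : IVar Var B E → Col}
    (hθ : O.IsInstantiation (C₁ ∪ D) θ) (hθ₂ : O.IsInstantiation C₂ θ₂)
    (hmark : O.mark hB C₁ θ = O.mark hB C₂ θ₂) :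
    O.IsConfiguration (C₂ ∪ fE '' D) := by
  have hs := hO.isSuffixHom h
  have hcl := hO.causallyClosed_extension hC hd hC₂ hs
  refine ⟨?_, ?_, hcl⟩
  · rintro e he e' he' ⟨b, t, t', hne, hb, hb', hle, hle'⟩
    have ht := hcl e he t hle
    have ht' := hcl e' he' t' hle'
    have key : ∀ u v : E, u ∈ C₂ → v ∈ D → u ≠ fE v → O.Consumes u b → O.Consumes (fE v) b →
        False := fun u v hu hv huv hub hvb =>
      (h.mapsTo_events hv).2.1 u hu ⟨b, u, fE v, huv, hub, hvb, .refl, .refl⟩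
    rcases ht with ht | ⟨t, ht, rfl⟩ <;> rcases ht' with ht' | ⟨t', ht', rfl⟩
    · exact hne (hC₂.eq_of_consumes ht ht' hb hb')
    · exact key _ _ ht ht' hne hb hb'
    · exact key _ _ ht' ht hne.symm hb' hb
    · obtain ⟨c, hc, rfl⟩ := hs.consumes ht hb
      obtain ⟨c', hc', heq⟩ := hs.consumes ht' hb'
      have := h.injOn_conds (Or.inl (Or.inr ⟨t', ht', hc'⟩)) (Or.inl (Or.inr ⟨t, ht, hc⟩)) heq
      subst this
      exact hne (congrArg fE (hC.eq_of_consumes (Or.inr ht) (Or.inr ht') hc hc'))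
  · obtain ⟨θ', hθ'⟩ :=
      hO.exists_isInstantiation_extension hN hC hfin₁ hfin₂ hd hC₂ h hθ hθ₂ hmark
    rw [ColorConflict, not_not]
    refine ⟨θ', ?_, ?_⟩
    · rintro e ⟨e', he', heq⟩
      cases heq
      exact hθ'.2 e he'
    · rintro b ⟨e', he', heq⟩
      cases heq

/-- If some `e₂` in `C₂ \ A` consumed `b`, equal label multisets would give an equally labelled `e₁`
in `C₁ \ A`. It consumes a condition `b₁` with the label of `b`, and safety forces `b₁ = b`, so `C₁`
consumes `b` after all. -/
theorem mem_cut_of_parikh_eq [LinearOrder T] (hO : IsBranchingProcess N O hB hE) (hN : N.Safe)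
    (hC₁ : O.IsConfiguration C₁) (hfin₁ : C₁.Finite) (hfin₂ : C₂.Finite) {A : Set E} (hA : O.CausallyClosed A) (hA₁ : A ⊆ C₁) (hA₂ : A ⊆ C₂)
    (hpar : parikh hE C₁ = parikh hE C₂) {b : B} (hb : b ∈ O.cut C₁) (hbA : b ∈ O.cut A) :
    b ∈ O.cut C₂ := by
  have hocc := hO.occurrence
  refine ⟨hbA.1.imp_right fun ⟨e, he, h⟩ => ⟨e, hA₂ he, h⟩, ?_⟩
  rintro ⟨e₂, he₂, hc₂⟩
  have he₂A : e₂ ∉ A := fun h => hbA.2 ⟨e₂, h, hc₂⟩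
  obtain ⟨e₁, ⟨he₁, he₁A⟩, hlab⟩ : ∃ e₁ ∈ C₁ \ A, hE e₁ = hE e₂ := by
    have h1 : ∀ C : Set E, C.Finite → A ⊆ C → ∑ᶠ e ∈ C, ({hE e} : Multiset T) =
        ∑ᶠ e ∈ C \ A, ({hE e} : Multiset T) + ∑ᶠ e ∈ A, ({hE e} : Multiset T) :=
      fun C hf hs => by
        rw [← finsum_mem_union Set.disjoint_sdiff_left (hf.subset Set.sdiff_subset) (hf.subset hs),
          Set.sdiff_union_of_subset hs]
    have h2 := parikh_eq_iff.1 hpar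
    rw [h1 C₁ hfin₁ hA₁, h1 C₂ hfin₂ hA₂, add_left_inj] at h2
    refine (mem_finsum_mem_singleton (hfin₁.subset Set.sdiff_subset) hE).1 ?_
    rw [h2]
    exact (mem_finsum_mem_singleton (hfin₂.subset Set.sdiff_subset) hE).2 ⟨e₂, ⟨he₂, he₂A⟩, rfl⟩
  obtain ⟨b₁, hc₁, hb₁⟩ : ∃ b₁, O.Consumes e₁ b₁ ∧ hB b₁ = hB b := by
    obtain ⟨x, hx⟩ := hc₂
    have h1 := hO.hom.pre e₁
    rw [hlab, hO.hom.pre e₂] at h1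
    have h2 := h1 ▸ Multiset.mem_map_of_mem (fun a : B × Var => (hB a.1, a.2)) hx
    obtain ⟨⟨b₁, y⟩, hy, heq⟩ := Multiset.mem_map.1 h2
    exact ⟨b₁, ⟨y, hy⟩, congrArg Prod.fst heq⟩
  -- Adding the strict past of `e₁` brings `b₁` into the cut, while `b` stays there because no event
  -- of `C₁` consumes it.
  set A' : Set E := A ∪ {e | O.NodeLT (Sum.inr e) (Sum.inr e₁)} with hA'
  have hA'C : A' ⊆ C₁ := Set.union_subset hA₁ fun e he =>
    CausallyClosed.mem_of_lt hC₁.causally_closed he₁ he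
  have hA'cl : O.CausallyClosed A' := by
    rintro e (he | he) e' hle
    · exact Or.inl (hA e he e' hle)
    · exact Or.inr (Relation.TransGen.trans_right hle he)
  have he₁A' : e₁ ∉ A' := by
    rintro (h | h)
    · exact he₁A h
    · exact hocc.acyclic _ h
  have hb₁cut : b₁ ∈ O.cut A' :=
    consumes_subset_cut hocc hC₁ he₁ hA'C he₁A' (fun e' h => Or.inr h) hc₁
  have hbcut : b ∈ O.cut A' :=
    ⟨hbA.1.imp_right fun ⟨e, he, h⟩ => ⟨e, Or.inl he, h⟩, fun ⟨e, he, h⟩ =>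
      hb.2 ⟨e, hA'C he, h⟩⟩
  obtain ⟨θ, hθ⟩ := hC₁.exists_isInstantiation ⟨e₁, he₁⟩
  have hinj := hO.injOn_cut hN (hfin₁.subset hA'C) (hC₁.subset hA'C hA'cl) (hθ.subset hA'C)
  exact hb.2 ⟨e₁, he₁, (hinj hb₁cut hbcut hb₁ : b₁ = b) ▸ hc₁⟩

/-- The whole postset of `e` lies in the cut of the causal past of `e`. -/
theorem injOn_produces (hO : IsBranchingProcess N O hB hE) (hN : N.Safe) {C : Set E}
    (hC : O.IsConfiguration C) (hfin : C.Finite) {e : E} (he : e ∈ C) :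
    Set.InjOn hB {b | O.Produces e b} := by
  have hocc := hO.occurrence
  set A : Set E := {e' | O.NodeLE (Sum.inr e') (Sum.inr e)} with hA
  have hAC : A ⊆ C := fun e' h => hC.causally_closed e he e' h
  have hAcl : O.CausallyClosed A := fun e' he' e'' hle => Relation.ReflTransGen.trans hle he'
  obtain ⟨θ, hθ⟩ := hC.exists_isInstantiation ⟨e, he⟩
  have hinj := hO.injOn_cut hN (hfin.subset hAC) (hC.subset hAC hAcl) (hθ.subset hAC)
  suffices hsub : {b | O.Produces e b} ⊆ O.cut A from hinj.mono hsub
  refine fun b hb => ⟨Or.inr ⟨e, (.refl : O.NodeLE _ _), hb⟩, ?_⟩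
  rintro ⟨e', he', hc⟩
  exact hocc.acyclic _ (Relation.TransGen.trans_left (nodeLT_of_produces_of_consumes hb hc) he')

/-- Causal induction: if `fB` fixes the preset of `e`, then `fE e` and `e` have the same label and
the same incoming arcs. Conditions produced inside `D` are fixed because their producers are; those
in the cut of `C₁` turn out to lie in the cut of `C₂` as well. -/
theorem suffixHom_eq_self [LinearOrder T] (hO : IsBranchingProcess N O hB hE) (hN : N.Safe)
    (hC : O.IsConfiguration (C₁ ∪ D)) (hfin : (C₁ ∪ D).Finite) (hd : Disjoint C₁ D)
    (hC₁ : O.IsConfiguration C₁) (hC₂ : O.IsConfiguration C₂) (hfin₂ : C₂.Finite)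
    (h : O.IsSuffixHom hB hE C₁ D C₂ fB fE) {θ₂ : IVar Var B E → Col}
    (hθ₂ : O.IsInstantiation C₂ θ₂) (hpar : parikh hE C₁ = parikh hE C₂) {n : ℕ}
    (hlow : O.lowerPart C₁ n = O.lowerPart C₂ n) {e : E} (he : e ∈ D)
    (hn : ¬ O.HeightGE (n + 1) e) : fE e = e := by
  have hocc := hO.occurrence
  have hfin₁ := hfin.subset (Set.subset_union_left (s := C₁) (t := D))
  have hinj := hO.injOn_cut hN hfin₂ hC₂ hθ₂
  have hwf : WellFounded fun e e' : E => O.NodeLT (Sum.inr e) (Sum.inr e') :=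
    InvImage.wf Sum.inr hocc.wellFounded
  induction e using hwf.induction with
  | _ e ih =>
    refine hO.inj _ _ ?_ (h.label_events e he)
    rw [h.pre e he]
    conv_rhs => rw [← Multiset.map_id (O.pre e)]
    refine Multiset.map_congr rfl fun a ha => Prod.ext ?_ rfl
    have hc : O.Consumes e a.1 := ⟨a.2, ha⟩
    change fB a.1 = a.1
    rcases mem_cut_or_mem_postSet hocc hC hd he hc with hb | ⟨e₀, he₀, x, hx⟩
    -- As `e` has height at most `n`, any producer of this condition has height below `n` and so
    -- lies in the lower part.
    · have hbA : a.1 ∈ O.cut (O.lowerPart C₁ n) := by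
        refine ⟨hb.1.imp_right fun ⟨e', he', hp⟩ => ⟨e', ⟨he', fun hge => ?_⟩, hp⟩,
          fun ⟨e', he', hp⟩ => hb.2 ⟨e', he'.1, hp⟩⟩
        exact hn ⟨e', nodeLT_of_produces_of_consumes hp hc, hge⟩
      have hb₂ := hO.mem_cut_of_parikh_eq hN hC₁ hfin₁ hfin₂
        (causallyClosed_lowerPart hC₁.causally_closed n) lowerPart_subset
        (hlow ▸ lowerPart_subset) hpar hb hbA
      exact hinj (h.cut hb) hb₂ (h.label_conds _ (Or.inl hb))
    · have hlt := nodeLT_of_produces_of_consumes ⟨x, hx⟩ hc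
      have hfix := ih e₀ hlt he₀ fun hge => hn ⟨e₀, hlt, hge.of_succ⟩
      have hp := h.mem_post he₀ hx
      rw [hfix] at hp
      exact hO.injOn_produces hN hC hfin (Or.inr he₀) ⟨x, hp⟩ ⟨x, hx⟩
        (h.label_conds _ (Or.inr ⟨e₀, he₀, x, hx⟩))

end IsBranchingProcess

end HLPetri

/-! ### Order laws and compatibility with extensions. -/

namespace HLPetri

open HLNet NetStructure

variable {Col Var P T B E : Type*} {N : HLNet Col Var P T} {O : HLNet Col Var B E}
  {hB : B → P} {hE : E → T} {C₁ D C₂ : Set E} {fB : B → B} {fE : E → E}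

theorem HLNet.foataSlice_union {D' : Set E} (hC : O.CausallyClosed C₁)
    (hCD : O.CausallyClosed (C₁ ∪ D')) (n : ℕ) :
    O.foataSlice (C₁ ∪ D') n =
      O.foataSlice C₁ n ∪ {e ∈ D' | O.HeightGE n e ∧ ¬ O.HeightGE (n + 1) e} := by
  ext e
  simp only [mem_foataSlice_iff hCD, Set.mem_union, mem_foataSlice_iff hC, Set.mem_ofPred_eq,
    or_and_right]

variable [LinearOrder T]

namespace HLNet

theorem FoataLT.irrefl {C : Set E} : ¬ O.FoataLT hE C C := fun ⟨_, _, _, _, h⟩ =>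
  irrefl_of (List.Shortlex (· < ·)) _ h

theorem FoataLT.trans {A B C : Set E} (hA : A.Finite) (hC : C.Finite)
    (hAc : O.CausallyClosed A) (hCc : O.CausallyClosed C) (hBf : B.Finite)
    (hBc : O.CausallyClosed B) (h₁ : O.FoataLT hE A B) (h₂ : O.FoataLT hE B C) :
    O.FoataLT hE A C := by
  have hfin : ∀ {X : Set E} (i : ℕ), X.Finite → O.CausallyClosed X → (O.foataSlice X i).Finite :=
    fun i hX hXc => hX.subset (foataSlice_subset hXc i)
  obtain ⟨i, hAi, hBi, hlt₁, hs₁⟩ := h₁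
  obtain ⟨j, hBj, hCj, hlt₂, hs₂⟩ := h₂
  rcases lt_trichotomy i j with hij | rfl | hij
  · exact ⟨i, hAi, nonempty_of_parikh_eq (hfin i hBf hBc) (hfin i hC hCc) (hlt₂ i hij) hBi,
      fun k hk => (hlt₁ k hk).trans (hlt₂ k (hk.trans hij)), hlt₂ i hij ▸ hs₁⟩
  · refine ⟨i, hAi, hCj, fun k hk => (hlt₁ k hk).trans (hlt₂ k hk), ?_⟩
    rw [List.shortlex_def] at hs₁ hs₂ ⊢
    rcases hs₁ with h₁ | ⟨h₁, h₁'⟩ <;> rcases hs₂ with h₂ | ⟨h₂, h₂'⟩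
    · exact Or.inl (h₁.trans h₂)
    · exact Or.inl (h₂ ▸ h₁)
    · exact Or.inl (h₁ ▸ h₂)
    · exact Or.inr ⟨h₁.trans h₂, List.lt_trans (α := T) h₁' h₂'⟩
  · exact ⟨j, nonempty_of_parikh_eq (hfin j hBf hBc) (hfin j hA hAc) (hlt₁ j hij).symm hBj, hCj,
      fun k hk => (hlt₁ k (hk.trans hij)).trans (hlt₂ k hk), (hlt₁ j hij).symm ▸ hs₂⟩

theorem parikhOrder_irrefl (C : O.FinConfig) : ¬ O.parikhOrder hE C C := by
  rintro (h | ⟨-, h⟩)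
  · exact lt_irrefl _ h
  · exact irrefl_of (List.Lex (· < ·)) _ h

theorem foataOrder_irrefl (C : O.FinConfig) : ¬ O.foataOrder hE C C := by
  rintro (h | ⟨-, h⟩ | ⟨-, h⟩)
  · exact lt_irrefl _ h
  · exact irrefl_of (List.Lex (· < ·)) _ h
  · exact h.irrefl

theorem ncard_eq_of_parikh_eq {C C' : O.FinConfig} (h : parikh hE C.1 = parikh hE C'.1) :
    C.1.ncard = C'.1.ncard := by
  rw [← length_parikh (hE := hE) C.2.2, h, length_parikh C'.2.2]

theorem parikhOrder_trans (A B C : O.FinConfig) (h₁ : O.parikhOrder hE A B)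
    (h₂ : O.parikhOrder hE B C) : O.parikhOrder hE A C := by
  rcases h₁ with h₁ | ⟨h₁, h₁'⟩ <;> rcases h₂ with h₂ | ⟨h₂, h₂'⟩
  · exact Or.inl (h₁.trans h₂)
  · exact Or.inl (h₂ ▸ h₁)
  · exact Or.inl (h₁ ▸ h₂)
  · exact Or.inr ⟨h₁.trans h₂, List.lt_trans (α := T) h₁' h₂'⟩

theorem foataOrder_trans (A B C : O.FinConfig) (h₁ : O.foataOrder hE A B)
    (h₂ : O.foataOrder hE B C) : O.foataOrder hE A C := by
  rcases h₁ with h₁ | ⟨h₁, h₁'⟩ | ⟨h₁, h₁'⟩ <;> rcases h₂ with h₂ | ⟨h₂, h₂'⟩ | ⟨h₂, h₂'⟩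
  · exact Or.inl (h₁.trans h₂)
  · exact Or.inl (h₂ ▸ h₁)
  · exact Or.inl (ncard_eq_of_parikh_eq h₂ ▸ h₁)
  · exact Or.inl (h₁ ▸ h₂)
  · exact Or.inr (Or.inl ⟨h₁.trans h₂, List.lt_trans (α := T) h₁' h₂'⟩)
  · exact Or.inr (Or.inl ⟨h₁.trans (ncard_eq_of_parikh_eq h₂), h₂ ▸ h₁'⟩)
  · exact Or.inl ((ncard_eq_of_parikh_eq h₁).symm ▸ h₂)
  · exact Or.inr (Or.inl ⟨(ncard_eq_of_parikh_eq h₁).trans h₂, h₁.symm ▸ h₂'⟩)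
  · exact Or.inr (Or.inr ⟨h₁.trans h₂, h₁'.trans A.2.2 C.2.2 A.2.1.causally_closed
      C.2.1.causally_closed B.2.2 B.2.1.causally_closed h₂'⟩)

end HLNet

namespace IsBranchingProcess

/-- Up to the deciding slice `n`, `D` and its image contribute the very same events. Earlier slices
thus keep equal labels, and slice `n` gains a common multiset, which preserves the comparison. -/
theorem foataLT_extension (hO : IsBranchingProcess N O hB hE) (hN : N.Safe)
    (hC₁ : O.IsConfiguration C₁) (hC₂ : O.IsConfiguration C₂)
    (hC₁D : O.IsConfiguration (C₁ ∪ D)) (hC₂D : O.IsConfiguration (C₂ ∪ fE '' D))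
    (hfin₁ : (C₁ ∪ D).Finite) (hfin₂ : (C₂ ∪ fE '' D).Finite)
    (hd₁ : Disjoint C₁ D) (hd₂ : Disjoint C₂ (fE '' D))
    (h : O.IsExtMono hB hE C₁ D C₂ fB fE) {θ θ₂ : IVar Var B E → Col}
    (hθ : O.IsInstantiation C₁ θ) (hθ₂ : O.IsInstantiation C₂ θ₂)
    (hpar : parikh hE C₁ = parikh hE C₂) (hlt : O.FoataLT hE C₁ C₂) :
    O.FoataLT hE (C₁ ∪ D) (C₂ ∪ fE '' D) := by
  obtain ⟨n, hne₁, hne₂, heq, hs⟩ := hlt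
  have hf₁ := hfin₁.subset (Set.subset_union_left (s := C₁) (t := D))
  have hf₂ := hfin₂.subset (Set.subset_union_left (s := C₂) (t := fE '' D))
  have hlow := hO.lowerPart_eq_of_parikh_eq hN hC₁ hC₂ hf₁ hf₂ heq
  have hD : ∀ j ≤ n, {e ∈ D | O.HeightGE j e ∧ ¬ O.HeightGE (j + 1) e} =
      {e ∈ fE '' D | O.HeightGE j e ∧ ¬ O.HeightGE (j + 1) e} := by
    intro j hj
    have hmono : ∀ e, ¬ O.HeightGE (j + 1) e → ¬ O.HeightGE (n + 1) e :=
      fun e he hge => he (hge.of_le (by omega))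
    refine Set.Subset.antisymm (fun e he => ⟨⟨e, he.1, ?_⟩, he.2⟩) (fun e he => ⟨?_, he.2⟩)
    · exact hO.suffixHom_eq_self hN hC₁D hfin₁ hd₁ hC₁ hC₂ hf₂ (hO.isSuffixHom h) hθ₂ hpar hlow
        he.1 (hmono e he.2.2)
    · have : Nonempty E := ⟨e⟩
      -- The inverse maps come from `Function.invFunOn`, which needs `B` inhabited. Without
      -- conditions every preset is empty, so labels alone identify events.
      by_cases hBn : Nonempty B
      · have h1 := hO.suffixHom_eq_self hN hC₂D hfin₂ hd₂ hC₂ hC₁ hf₁ (hO.isSuffixHom_inverse h) hθ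
          hpar.symm hlow.symm he.1 (hmono e he.2.2)
        obtain ⟨e', he', rfl⟩ := he.1
        rw [h.injOn_events.leftInvOn_invFunOn he'] at h1
        exact h1 ▸ he'
      · obtain ⟨e', he', rfl⟩ := he.1
        have hz : ∀ e'', O.pre e'' = 0 := fun e'' =>
          Multiset.eq_zero_of_forall_notMem fun a _ => hBn ⟨a.1⟩
        rwa [hO.inj (fE e') e' (by rw [hz, hz]) (h.label_events e' he')]
  have hslice : ∀ j ≤ n, parikh hE (O.foataSlice (C₁ ∪ D) j) =
        (∑ᶠ e ∈ O.foataSlice C₁ j, ({hE e} : Multiset T) +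
          ∑ᶠ e ∈ {e ∈ D | O.HeightGE j e ∧ ¬ O.HeightGE (j + 1) e}, {hE e}).sort (· ≤ ·) ∧
      parikh hE (O.foataSlice (C₂ ∪ fE '' D) j) =
        (∑ᶠ e ∈ O.foataSlice C₂ j, ({hE e} : Multiset T) +
          ∑ᶠ e ∈ {e ∈ D | O.HeightGE j e ∧ ¬ O.HeightGE (j + 1) e}, {hE e}).sort (· ≤ ·) := by
    intro j hj
    have hs₁ := foataSlice_subset hC₁.causally_closed j
    have hs₂ := foataSlice_subset hC₂.causally_closed j
    constructor
    · rw [foataSlice_union hC₁.causally_closed hC₁D.causally_closed,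
        parikh_union (hd₁.mono hs₁ (Set.sep_subset _ _)) (hf₁.subset hs₁)
          (hfin₁.subset ((Set.sep_subset _ _).trans Set.subset_union_right))]
    · rw [foataSlice_union hC₂.causally_closed hC₂D.causally_closed,
        parikh_union (hd₂.mono hs₂ (Set.sep_subset _ _)) (hf₂.subset hs₂)
          (hfin₂.subset ((Set.sep_subset _ _).trans Set.subset_union_right)), hD j hj]
  refine ⟨n, ?_, ?_, fun j hj => ?_, ?_⟩
  · rw [foataSlice_union hC₁.causally_closed hC₁D.causally_closed]
    exact hne₁.inl
  · rw [foataSlice_union hC₂.causally_closed hC₂D.causally_closed]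
    exact hne₂.inl
  · rw [(hslice j hj.le).1, (hslice j hj.le).2, parikh_eq_iff.1 (heq j hj)]
  · rw [(hslice n le_rfl).1, (hslice n le_rfl).2]
    exact shortlex_sort_add hs _

/-- The extended configuration does not depend on the order, so all three are treated at once. -/
theorem exists_extension (hO : IsBranchingProcess N O hB hE) (hN : N.Safe)
    (C₁ C₂ C₁' : O.FinConfig) (D : Set E) (hd : Disjoint C₁.1 D) (hC₁' : C₁'.1 = C₁.1 ∪ D)
    (hM : ∃ M ∈ O.marks hB C₁.1 ∩ O.marks hB C₂.1, O.CanExtend hB C₁.1 M D)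
    (fB : B → B) (fE : E → E) (h : O.IsExtMono hB hE C₁.1 D C₂.1 fB fE) :
    ∃ C₂' : O.FinConfig, Disjoint C₂.1 (fE '' D) ∧ C₂'.1 = C₂.1 ∪ fE '' D ∧
      (O.sizeOrder C₁ C₂ → O.sizeOrder C₁' C₂') ∧
      (O.parikhOrder hE C₁ C₂ → O.parikhOrder hE C₁' C₂') ∧
      (O.foataOrder hE C₁ C₂ → O.foataOrder hE C₁' C₂') := by
  obtain ⟨C₁, hC₁, hf₁⟩ := C₁
  obtain ⟨C₂, hC₂, hf₂⟩ := C₂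
  obtain ⟨C₁', hC, hf⟩ := C₁'
  dsimp only at hd hC₁' hM h ⊢
  subst hC₁'
  obtain ⟨M, ⟨-, θ₂, hθ₂, hm₂⟩, θ, hθ, hm⟩ := hM
  have hd₂ := disjoint_extension h
  have hCfg := hO.isConfiguration_extension hN hC hf₁ hf₂ hd hC₂ h hθ hθ₂ (hm.trans hm₂.symm)
  have hDf : D.Finite := hf.subset Set.subset_union_right
  have hf' := hf₂.union (hDf.image fE)
  have hcard₁ : (C₁ ∪ D).ncard = C₁.ncard + D.ncard := Set.ncard_union_eq hd hf₁ hDf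
  have hcard₂ : (C₂ ∪ fE '' D).ncard = C₂.ncard + D.ncard := by
    rw [Set.ncard_union_eq hd₂ hf₂ (hDf.image fE), h.injOn_events.ncard_image]
  have hpar₁ := parikh_union (hE := hE) hd hf₁ hDf
  have hpar₂ := parikh_union (hE := hE) hd₂ hf₂ (hDf.image fE)
  rw [finsum_mem_image_label h.injOn_events h.label_events] at hpar₂
  have hsize : C₁.ncard < C₂.ncard → (C₁ ∪ D).ncard < (C₂ ∪ fE '' D).ncard := fun hlt => by
    rw [hcard₁, hcard₂]
    omega
  have hlex : C₁.ncard = C₂.ncard ∧ List.Lex (· < ·) (parikh hE C₁) (parikh hE C₂) →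
      (C₁ ∪ D).ncard = (C₂ ∪ fE '' D).ncard ∧
        List.Lex (· < ·) (parikh hE (C₁ ∪ D)) (parikh hE (C₂ ∪ fE '' D)) := by
    rintro ⟨hc, hl⟩
    refine ⟨by rw [hcard₁, hcard₂, hc], ?_⟩
    rw [hpar₁, hpar₂]
    refine lex_sort_add hl ?_ _
    have h1 := length_parikh (hE := hE) hf₁
    have h2 := length_parikh (hE := hE) hf₂
    rw [parikh, Multiset.length_sort] at h1 h2
    rw [h1, h2, hc]
  refine ⟨⟨C₂ ∪ fE '' D, hCfg, hf'⟩, hd₂, rfl, hsize, Or.imp hsize hlex,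
    Or.imp hsize (Or.imp hlex ?_)⟩
  rintro ⟨hp, hlt⟩
  refine ⟨?_, hO.foataLT_extension hN hC₁ hC₂ hC hCfg hf hf' hd hd₂ h
    (hθ.subset Set.subset_union_left) hθ₂ hp hlt⟩
  rw [hpar₁, hpar₂, parikh_eq_iff.1 hp]

end IsBranchingProcess

end HLPetri

theorem mainTheorem11 {Col Var P T : Type*} {B : Type*} {E : Type*}
    [Nonempty Col] [Finite P] [Finite T] [LinearOrder T]
    (N : HLPetri.HLNet Col Var P T) (hN : N.Safe)
    (O : HLPetri.HLNet Col Var B E) (hB : B → P) (hE : E → T)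
    (hU : HLPetri.IsSymbolicUnfolding N O hB hE) :
    O.IsAdequateOrder hB hE O.sizeOrder ∧
    O.IsAdequateOrder hB hE (O.parikhOrder hE) ∧
    O.IsAdequateOrder hB hE (O.foataOrder hE) ∧
    (∀ C₁ C₂ : O.FinConfig,
      O.foataOrder hE C₁ C₂ ∨ C₁ = C₂ ∨ O.foataOrder hE C₂ C₁) := by
  have hO := hU.1
  have hfin := hO.finite_finConfig_ncard_le hN
  have hsub : ∀ C₁ C₂ : O.FinConfig, C₁.1 ⊂ C₂.1 → C₁.1.ncard < C₂.1.ncard :=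
    fun C₁ C₂ h => Set.ncard_lt_ncard h C₂.2.2
  refine ⟨⟨fun C => lt_irrefl _, fun _ _ _ => lt_trans, InvImage.wf _ wellFounded_lt, hsub, ?_⟩,
    ⟨HLPetri.HLNet.parikhOrder_irrefl, HLPetri.HLNet.parikhOrder_trans,
      HLPetri.wellFounded_of_finite_size_le HLPetri.HLNet.parikhOrder_irrefl
        HLPetri.HLNet.parikhOrder_trans (fun C => C.1.ncard) ?_ hfin,
      fun C₁ C₂ h => Or.inl (hsub C₁ C₂ h), ?_⟩,
    ⟨HLPetri.HLNet.foataOrder_irrefl, HLPetri.HLNet.foataOrder_trans,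
      HLPetri.wellFounded_of_finite_size_le HLPetri.HLNet.foataOrder_irrefl
        HLPetri.HLNet.foataOrder_trans (fun C => C.1.ncard) ?_ hfin,
      fun C₁ C₂ h => Or.inl (hsub C₁ C₂ h), ?_⟩,
    hO.foataOrder_trichotomous hN⟩
  · intro C₁ C₂ C₁' D hd hC hM fB fE h
    obtain ⟨C₂', h1, h2, h3, -, -⟩ := hO.exists_extension hN C₁ C₂ C₁' D hd hC hM fB fE h
    exact ⟨C₂', h1, h2, h3⟩
  · rintro C₁ C₂ (h | h)
    exacts [h.le, h.1.le]
  · intro C₁ C₂ C₁' D hd hC hM fB fE h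
    obtain ⟨C₂', h1, h2, -, h3, -⟩ := hO.exists_extension hN C₁ C₂ C₁' D hd hC hM fB fE h
    exact ⟨C₂', h1, h2, h3⟩
  · rintro C₁ C₂ (h | h | h)
    exacts [h.le, h.1.le, (HLPetri.HLNet.ncard_eq_of_parikh_eq h.1).le]
  · intro C₁ C₂ C₁' D hd hC hM fB fE h
    obtain ⟨C₂', h1, h2, -, -, h3⟩ := hO.exists_extension hN C₁ C₂ C₁' D hd hC hM fB fE h
    exact ⟨C₂', h1, h2, h3⟩
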